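/- Let $\Omega\subset\mathbb R^3$ be a bounded domain whose closure is polyhedral, with a finite triangulation $\mathcal T$, and whose boundary is locally flat (every $x\in\partial\Omega$ has an open neighbourhood $U_x$ in $\mathbb R^3$ and a homeomorphism $U_x\to\mathbb R^3$ carrying $U_x\cap\partial\Omega$ onto the plane $\{z=0\}$). Let $\Gamma_0,\dots,\Gamma_p$ be the distinct connected components of $\partial\Omega$, let $D_r$ be the bounded connected component of $\mathbb R^3\setminus\Gamma_r$, and let $\Gamma_0$ be the external component, i.e. $\overline\Omega=\overline{D_0}\setminus\bigcup_{r=1}^pD_r$. Chains are piecewise linear with integer coefficients, $|c|$ is the support of a chain $c$, and $[c]_Z$ is the class in $H_1(Z;\mathbb Z)$ of a $1$-cycle $c$ with $|c|\subset Z$. Let $g_r$ be the first Betti number of $\overline{D_r}$. For each $r\in\{0,\dots,p\}$ let $\sigma_{r,1},\dots,\sigma_{r,g_r},\widehat\sigma_{r,1},\dots,\widehat\sigma_{r,g_r}$ be $1$-cycles of $\mathcal T$ with support in $\Gamma_r$ such that - $\{[\sigma_{r,s}]_{\overline{D_r}}\}_{s}$ is a basis of $H_1(\overline{D_r};\mathbb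 Z)$, and $[\sigma_{r,s}]_{\mathbb R^3\setminus D_r}=0$ for all $s$; - $\{[\widehat\sigma_{r,s}]_{\mathbb R^3\setminus D_r}\}_{s}$ is a basis of $H_1(\mathbb R^3\setminus D_r;\mathbb Z)$, and $[\widehat\sigma_{r,s}]_{\overline{D_r}}=0$ for all $s$. Let $\widehat\sigma_{0,s}^-$ $(1\le s\le g_0)$ and $\sigma_{r,s}^-$ $(1\le r\le p,\ 1\le s\le g_r)$ be $1$-cycles with support in $\mathbb R^3\setminus\overline\Omega$ such that $[\widehat\sigma_{0,s}^-]_{\mathbb R^3\setminus\Omega}=[\widehat\sigma_{0,s}]_{\mathbb R^3\setminus\Omega}$ and $[\sigma_{r,s}^-]_{\mathbb R^3\setminus\Omega}=[\sigma_{r,s}]_{\mathbb R^3\setminus\Omega}$. For $1$-cycles $\gamma,\eta$ with $|\gamma|\cap|\eta|=\emptyset$, the linking number is $\mathrm{lk}(\gamma,\eta)=\sum_{m,q}a_mb_qL_{mq}$, where $S=\sum_q b_qf_q$ is a $2$-chain of nondegenerate oriented triangles with $\partial S=\eta$, where $\gamma'=\sum_m a_me_m$ is a $1$-cycle homologous to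 $\gamma$ in $\mathbb R^3\setminus|\eta|$ such that each $|e_m|\cap|f_q|$ is empty or a single point outside $|\partial e_m|\cup|\partial f_q|$, and where $L_{mq}=0$ if $|e_m|\cap|f_q|=\emptyset$ and otherwise $L_{mq}$ is the sign of the scalar product of the tangent vector of $e_m$ with the normal vector of $f_q$. For $k,i\in\{1,\dots,p\}$ define the integer matrices (rows indexed by $l$, columns by $j$) $$A_{0,0}=\big(\mathrm{lk}(\widehat\sigma_{0,l}^-,\sigma_{0,j})\big),\quad A_{0,i}=\big(\mathrm{lk}(\widehat\sigma_{0,l}^-,\widehat\sigma_{i,j})\big),\quad A_{k,0}=\big(\mathrm{lk}(\sigma_{k,l}^-,\sigma_{0,j})\big),\quad A_{k,i}=\big(\mathrm{lk}(\sigma_{k,l}^-,\widehat\sigma_{i,j})\big).$$ Then all these linking numbers are well defined (the data $S,\gamma'$ exist, and the value does not depend on their choice). For all $k,i\in\{1,\dots,p\}$ we have $A_{0,i}=0$ and $A_{k,0}=0$, and $A_{k,i}=0$ if $k\ne i$. Consequently, for every $r\in\{0,\dots,p\}$ the square matrix $(A_{k,i})_{k,i\in\{0,\dots,p\}\setminus\{r\}}$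 is block diagonal with diagonal blocks $A_{k,k}$, $k\ne r$. (It is the coefficient matrix of the linear system $\sum_{i\ne r}A_{k,i}\,\alpha^{r,s}_i=\beta^{r,s}_k$, $k\neq r$, for the integer vectors $\alpha^{r,s}_i\in\mathbb Z^{g_i}$, $i\ne r$, where $\beta^{r,s}_k\in\mathbb Z^{g_k}$ are given vectors.) -/

import Mathlib

open scoped Matrix

noncomputable section

namespace PL

/-- The space `ℝ³`.  Only its topology, its bounded sets, its affine structure, and the dot and
cross products are used below. -/
abbrev R3 : Type := Fin 3 → ℝ

/-! ### Piecewise linear chains with integer coefficients -/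

/-- Piecewise linear `1`-chains of `ℝ³`: finite formal integral combinations of oriented segments
`[a, b]`, `a ≠ b`, with `[b, a] = -[a, b]`.  A chain is stored as its coefficient function:
`c (a, b)` is the coefficient of `[a, b]`, and `c (b, a) = -c (a, b)` (so `c (a, a) = 0`). -/
def C1 : AddSubgroup (R3 × R3 →₀ ℤ) where
  carrier := {c | ∀ a b, c (b, a) = -c (a, b)}
  zero_mem' := by simp
  add_mem' := by
    intro c d hc hd a b
    simp only [Finsupp.add_apply, hc a b, hd a b]
    ring
  neg_mem' := by
    intro c hc a b
    simp only [Finsupp.neg_apply, hc a b]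

/-- Piecewise linear `2`-chains of `ℝ³`: finite formal integral combinations of oriented triangles
`[x, y, z]` with distinct vertices, an odd permutation of the vertices changing the sign.  A chain
is stored as its alternating coefficient function.  Collinear triples are allowed: they are needed
for a segment to be homologous to its subdivisions inside its own support. -/
def C2 : AddSubgroup (R3 × R3 × R3 →₀ ℤ) where
  carrier := {c | ∀ x y z, c (y, x, z) = -c (x, y, z) ∧ c (x, z, y) = -c (x, y, z)}
  zero_mem' := by simp
  add_mem' := by
    intro c d hc hd x y z
    simp only [Finsupp.add_apply, (hc x y z).1, (hc x y z).2, (hd x y z).1, (hd x y z).2]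
    constructor <;> ring
  neg_mem' := by
    intro c hc x y z
    simp only [Finsupp.neg_apply, (hc x y z).1, (hc x y z).2, and_self]

/-- The boundary `∂₁ [a, b] = b - a`: the coefficient of the point `b` in `∂₁ c` is the sum over
`a` of the coefficients of `[a, b]` in `c`. -/
def bdry1 : C1 →+ (R3 →₀ ℤ) :=
  (Finsupp.mapDomain.addMonoidHom (Prod.snd : R3 × R3 → R3)).comp C1.subtype

/-- The boundary `∂₂ [x, y, z] = [y, z] + [z, x] + [x, y]`: the coefficient of the segment `[y, z]`
in `∂₂ c` is the sum over `x` of the coefficients of `[x, y, z]` in `c`. -/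
def bdry2 : C2 →+ C1 :=
  ((Finsupp.mapDomain.addMonoidHom (Prod.snd : R3 × R3 × R3 → R3 × R3)).comp
    C2.subtype).codRestrict C1 (by
      rintro ⟨c, hc⟩ a b
      have h1 : Finsupp.mapDomain (fun t : R3 × R3 × R3 => (t.1, t.2.swap)) c = -c := by
        ext ⟨x, y, z⟩
        have hinj : Function.Injective (fun t : R3 × R3 × R3 => (t.1, t.2.swap)) := by
          rintro ⟨x, y, z⟩ ⟨x', y', z'⟩ h
          simp only [Prod.swap_prod_mk, Prod.mk.injEq] at h
          simp [h.1, h.2.1, h.2.2]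
        have := Finsupp.mapDomain_apply hinj c (x, z, y)
        simp only [Prod.swap_prod_mk] at this
        rw [this, Finsupp.neg_apply, (hc x y z).2]
      have h2 : Finsupp.mapDomain Prod.swap (Finsupp.mapDomain Prod.snd c) =
          -Finsupp.mapDomain (Prod.snd : R3 × R3 × R3 → R3 × R3) c := by
        rw [← Finsupp.mapDomain_comp]
        have : (Prod.swap ∘ Prod.snd : R3 × R3 × R3 → R3 × R3) =
            Prod.snd ∘ (fun t : R3 × R3 × R3 => (t.1, t.2.swap)) := rfl
        rw [this, Finsupp.mapDomain_comp, h1]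
        exact map_neg (Finsupp.mapDomain.addMonoidHom Prod.snd) c
      have h3 := Finsupp.mapDomain_apply (Prod.swap_injective (α := R3) (β := R3))
        (Finsupp.mapDomain (Prod.snd : R3 × R3 × R3 → R3 × R3) c) (a, b)
      rw [h2] at h3
      simp only [Prod.swap_prod_mk, Finsupp.neg_apply] at h3
      change Finsupp.mapDomain Prod.snd c (b, a) = -Finsupp.mapDomain Prod.snd c (a, b)
      rw [← h3, neg_neg])

/-- The oriented segment `[a, b]` as a `1`-chain. -/
def seg (a b : R3) : C1 :=
  ⟨Finsupp.single (a, b) 1 - Finsupp.single (b, a) 1, by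
    classical
    intro x y
    simp only [Finsupp.sub_apply, Finsupp.single_apply, Prod.mk.injEq]
    grind⟩

/-- The oriented triangle `[x, y, z]` as a `2`-chain. -/
def tri (x y z : R3) : C2 :=
  ⟨Finsupp.single (x, y, z) 1 + Finsupp.single (y, z, x) 1 + Finsupp.single (z, x, y) 1
    - Finsupp.single (y, x, z) 1 - Finsupp.single (x, z, y) 1 - Finsupp.single (z, y, x) 1, by
    classical
    intro u v w
    obtain ⟨δ, hδ⟩ : ∃ δ : R3 → R3 → ℤ, ∀ a b c u v w : R3,
        Finsupp.single (a, b, c) (1 : ℤ) (u, v, w) = δ a u * δ b v * δ c w := by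
      refine ⟨fun a u => if a = u then 1 else 0, fun a b c u v w => ?_⟩
      by_cases h1 : a = u <;> by_cases h2 : b = v <;> by_cases h3 : c = w <;>
        simp [Finsupp.single_apply, h1, h2, h3]
    simp only [Finsupp.sub_apply, Finsupp.add_apply, hδ]
    constructor <;> ring⟩

/-- The support `|c|` of a `1`-chain: the union of its segments. -/
def supp1 (c : C1) : Set R3 :=
  {x | ∃ a b, (c : R3 × R3 →₀ ℤ) (a, b) ≠ 0 ∧ x ∈ segment ℝ a b}

/-! ### First homology of a subset of `ℝ³` -/

/-- The `1`-cycles with support contained in `Z`. -/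
def cycles (Z : Set R3) : AddSubgroup C1 where
  carrier := {c | bdry1 c = 0 ∧ supp1 c ⊆ Z}
  zero_mem' := by
    refine ⟨map_zero _, ?_⟩
    rintro x ⟨a, b, h, -⟩
    simp at h
  add_mem' := by
    rintro c d ⟨hc, hc'⟩ ⟨hd, hd'⟩
    refine ⟨by rw [map_add, hc, hd, add_zero], ?_⟩
    rintro x ⟨a, b, h, hx⟩
    by_cases h0 : (c : R3 × R3 →₀ ℤ) (a, b) = 0
    · refine hd' ⟨a, b, ?_, hx⟩
      intro h1
      simp [h0, h1] at h
    · exact hc' ⟨a, b, h0, hx⟩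
  neg_mem' := by
    rintro c ⟨hc, hc'⟩
    refine ⟨by rw [map_neg, hc, neg_zero], ?_⟩
    rintro x ⟨a, b, h, hx⟩
    refine hc' ⟨a, b, ?_, hx⟩
    intro h1
    simp [h1] at h

/-- The `2`-chains with support contained in `Z`. -/
def chains2 (Z : Set R3) : AddSubgroup C2 where
  carrier := {S | ∀ x y z, (S : R3 × R3 × R3 →₀ ℤ) (x, y, z) ≠ 0 → convexHull ℝ {x, y, z} ⊆ Z}
  zero_mem' := by simp
  add_mem' := by
    intro S T hS hT x y z h
    by_cases h0 : (S : R3 × R3 × R3 →₀ ℤ) (x, y, z) = 0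
    · refine hT x y z ?_
      intro h1
      simp [h0, h1] at h
    · exact hS x y z h0
  neg_mem' := by
    intro S hS x y z h
    refine hS x y z ?_
    intro h1
    simp [h1] at h

/-- The `1`-boundaries in `Z`: boundaries of `2`-chains with support contained in `Z`. -/
def boundaries (Z : Set R3) : AddSubgroup C1 := (chains2 Z).map bdry2

/-- The first homology group `H₁(Z; ℤ)`, computed with piecewise linear chains.  It is used only for
open subsets of `ℝ³` and for polyhedral sets, where it is the usual (singular) homology. -/
abbrev H1 (Z : Set R3) : Type := cycles Z ⧸ (boundaries Z).addSubgroupOf (cycles Z)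

/-- The homology class `[c]_Z`. -/
def homologyClass (Z : Set R3) (c : cycles Z) : H1 Z := QuotientAddGroup.mk c

/-- The classes in `Z` of the members of the family `c` (which are cycles in `Z`) form a basis of
`H₁(Z; ℤ)`. -/
def IsHomologyBasis {ι : Type} (Z : Set R3) (c : ι → C1) : Prop :=
  ∃ (hc : ∀ s, c s ∈ cycles Z) (b : Module.Basis ι ℤ (H1 Z)),
    ∀ s, b s = homologyClass Z ⟨c s, hc s⟩

/-- `[c]_Z = 0`. -/
def BoundsIn (Z : Set R3) (c : C1) : Prop :=
  ∃ hc : c ∈ cycles Z, homologyClass Z ⟨c, hc⟩ = 0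

/-- `[c]_Z = [d]_Z`. -/
def HomologousIn (Z : Set R3) (c d : C1) : Prop :=
  ∃ (hc : c ∈ cycles Z) (hd : d ∈ cycles Z), homologyClass Z ⟨c, hc⟩ = homologyClass Z ⟨d, hd⟩

/-! ### The linking number -/

/-- A nondegenerate oriented segment. -/
structure OSegment where
  a : R3
  b : R3
  ne : a ≠ b

/-- A nondegenerate oriented triangle. -/
structure OTriangle where
  x : R3
  y : R3
  z : R3
  indep : AffineIndependent ℝ ![x, y, z]

/-- The oriented segment as a `1`-chain. -/
def OSegment.chain (e : OSegment) : C1 := seg e.a e.b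

/-- The oriented triangle as a `2`-chain. -/
def OTriangle.chain (f : OTriangle) : C2 := tri f.x f.y f.z

/-- The support `|e|`. -/
def OSegment.supp (e : OSegment) : Set R3 := segment ℝ e.a e.b

/-- The support `|f|`. -/
def OTriangle.supp (f : OTriangle) : Set R3 := convexHull ℝ {f.x, f.y, f.z}

/-- The support `|∂₂ f|`: the union of the three sides. -/
def OTriangle.suppBdry (f : OTriangle) : Set R3 :=
  segment ℝ f.x f.y ∪ segment ℝ f.y f.z ∪ segment ℝ f.z f.x

/-- `|e| ∩ |f|` is empty, or a single point lying neither in `|∂₁ e|` nor in `|∂₂ f|`. -/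
def Transverse (e : OSegment) (f : OTriangle) : Prop :=
  e.supp ∩ f.supp = ∅ ∨
    ∃ x, e.supp ∩ f.supp = {x} ∧ x ∉ ({e.a, e.b} : Set R3) ∪ f.suppBdry

open Classical in
/-- The local intersection number: `0` if `|e| ∩ |f|` is empty, and `sign (τ(e) · ν(f))` otherwise.
The tangent and normal vectors are not normalised, which does not affect the sign. -/
def localIndex (e : OSegment) (f : OTriangle) : ℤ :=
  if e.supp ∩ f.supp = ∅ then 0
  else (SignType.sign ((e.b - e.a) ⬝ᵥ ((f.y - f.x) ⨯₃ (f.z - f.x))) : ℤ)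

/-- The integer `n` is obtained as a linking number of `γ` and `η`: there are a `2`-chain
`S = ∑ b_q f_q` of nondegenerate triangles with `∂₂ S = η` and a `1`-cycle `γ' = ∑ a_p e_p`
homologous to `γ` in `ℝ³ \ |η|` and transverse to `S`, with
`n = ∑ a_p b_q L_pq`. -/
def IsLinkingNumber (γ η : C1) (n : ℤ) : Prop :=
  ∃ (h k : ℕ) (a : Fin h → ℤ) (e : Fin h → OSegment) (b : Fin k → ℤ) (f : Fin k → OTriangle),
    bdry2 (∑ q, b q • (f q).chain) = η ∧
    HomologousIn (supp1 η)ᶜ γ (∑ p, a p • (e p).chain) ∧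
    (∀ p q, Transverse (e p) (f q)) ∧
    n = ∑ p, ∑ q, a p * b q * localIndex (e p) (f q)

open Classical in
/-- The linking number of `γ` and `η` (with the value `0` where no linking number exists). -/
def linkingNumber (γ η : C1) : ℤ :=
  if h : ∃ n, IsLinkingNumber γ η n then h.choose else 0

/-! ### Domains and boundary components -/

/-- A subset of `ℝ³` that is locally flat: near each of its points it looks, up to a homeomorphism
of an open neighbourhood with `ℝ³`, like the plane `{z = 0}`. -/
def LocallyFlat (S : Set R3) : Prop :=
  ∀ x ∈ S, ∃ U : Set R3, IsOpen U ∧ x ∈ U ∧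
    ∃ φ : U ≃ₜ R3, ∀ y : U, (y : R3) ∈ S ↔ φ y 2 = 0

/-- `D` is a bounded connected component of `ℝ³ \ K`. -/
def IsBoundedComponent (K D : Set R3) : Prop :=
  Bornology.IsBounded D ∧ ∃ x ∈ Kᶜ, D = connectedComponentIn Kᶜ x

/-- `c` is a `1`-chain of the simplicial complex `T`: its segments are edges of `T`. -/
def IsChainOf (T : Geometry.SimplicialComplex ℝ R3) (c : C1) : Prop :=
  ∀ a b, (c : R3 × R3 →₀ ℤ) (a, b) ≠ 0 → ∃ s ∈ T.faces, (s : Set R3) = {a, b}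

/-! ### The linking matrices -/

/-- From the cycles `σ_{r,s}` and `σ̂_{r,s}`, the family `σ̂_{0,s}`, and `σ_{r,s}` for `r ≥ 1`. -/
def outer {p : ℕ} {g : Fin (p + 1) → ℕ} (σ σh : ∀ r, Fin (g r) → C1) :
    ∀ r, Fin (g r) → C1 :=
  fun r s => if r = 0 then σh r s else σ r s

/-- From the cycles `σ_{r,s}` and `σ̂_{r,s}`, the family `σ_{0,s}`, and `σ̂_{r,s}` for `r ≥ 1`. -/
def inner {p : ℕ} {g : Fin (p + 1) → ℕ} (σ σh : ∀ r, Fin (g r) → C1) :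
    ∀ r, Fin (g r) → C1 :=
  fun r s => if r = 0 then σ r s else σh r s

/-- The `g_k × g_i` matrix `A_{k,i}` of the linking numbers of the `c_{k,l}` with the `d_{i,j}`. -/
def linkingMatrix {p : ℕ} {g : Fin (p + 1) → ℕ} (c d : ∀ r, Fin (g r) → C1)
    (k i : Fin (p + 1)) : Matrix (Fin (g k)) (Fin (g i)) ℤ :=
  Matrix.of fun l j => linkingNumber (c k l) (d i j)

/-- The square matrix assembled from the blocks `A_{k,i}` with `k ≠ r` and `i ≠ r`: the coefficient
matrix of the linear system for the unknowns `α^{r,s}_{i,j}`, `i ≠ r`, `1 ≤ j ≤ g_i`. -/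
def systemMatrix {p : ℕ} {g : Fin (p + 1) → ℕ}
    (A : ∀ k i, Matrix (Fin (g k)) (Fin (g i)) ℤ) (r : Fin (p + 1)) :
    Matrix (Σ k : {k : Fin (p + 1) // k ≠ r}, Fin (g k))
      (Σ i : {i : Fin (p + 1) // i ≠ r}, Fin (g i)) ℤ :=
  Matrix.of fun u v => A u.1 v.1 u.2 v.2

end PL

end

noncomputable section

namespace PL

/-! ### Elementary chain algebra -/

/-! Fix a direction `w` and count the signed crossings of `c` with the half-infinite strips `d + [0,
∞) w`. This count, `crossForm w c d`, is bilinear and defined for all chains, without any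
transversality. The local fact behind everything is that a segment crossing the boundary of the half
prism over a triangle changes the prism's signed indicator by the signed number of crossings
(`crossing_bdry_triangle`). The indicators at the end points telescope along a cycle. So, for almost
every `w`, the form vanishes on a cycle and the boundary of a `2`-chain disjoint from it, and equals
four times any linking number of the pair (`IsLinkingNumber.ae_eq_crossForm`). Uniqueness follows,
because two full-measure sets of directions meet. Existence comes from a cone over `d` with generic
apex and a small generic translation of `c`.

For the vanishing, let `c` be a retracted cycle, homologous outside `Ω` to `c'` on `Γ k`, and let
`d` lie on `Γ i` with `k ≠ i`. The cycle `d` bounds on the side of `Γ i` away from `Ω`, hence away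
from `Γ k`, so `c'` does not link `d`. But the homology from `c` to `c'` may touch `Γ i`, so it need
not preserve the linking with `d`. Therefore `d` is first pushed to a cycle `d'` inside `Ω`, by a
homology avoiding both `|c|` and `Γ k` (`exists_push`). Then lk(c, d) = lk(c, d') = lk(c', d') =
lk(c', d) = 0 (`IsLinkingNumber.eq_zero`).

Pushing requires that `Ω` lie locally on one side of `Γ i`. Local flatness gives two local sides. An
open set outside `Ω` with frontier in `Γ i` accumulates at every point of `Γ i` by connectedness
(`LocallyFlat.subset_closure`), so it fills one side and leaves the other to `Ω`
(`LocallyFlat.isLocallyConnectedNear`). -/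

theorem coe_seg (a b : R3) :
    ((seg a b : C1) : R3 × R3 →₀ ℤ) = Finsupp.single (a, b) 1 - Finsupp.single (b, a) 1 := rfl

theorem seg_swap (a b : R3) : seg b a = -seg a b := by
  apply Subtype.ext
  simp only [coe_seg, AddSubgroup.coe_neg, neg_sub]

theorem bdry1_seg (a b : R3) : bdry1 (seg a b) = Finsupp.single b 1 - Finsupp.single a 1 := by
  change Finsupp.mapDomain.addMonoidHom (M := ℤ) (Prod.snd : R3 × R3 → R3)
    (Finsupp.single (a, b) 1 - Finsupp.single (b, a) 1) = _
  rw [map_sub]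
  simp [Finsupp.mapDomain.addMonoidHom]

theorem coe_bdry2 (S : C2) : ((bdry2 S : C1) : R3 × R3 →₀ ℤ) =
    Finsupp.mapDomain (Prod.snd : R3 × R3 × R3 → R3 × R3) (S : R3 × R3 × R3 →₀ ℤ) := rfl

theorem bdry2_tri (x y z : R3) : bdry2 (tri x y z) = seg y z + seg z x + seg x y := by
  apply Subtype.ext
  change Finsupp.mapDomain.addMonoidHom (M := ℤ) (Prod.snd : R3 × R3 × R3 → R3 × R3)
    (Finsupp.single (x, y, z) 1 + Finsupp.single (y, z, x) 1 + Finsupp.single (z, x, y) 1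
    - Finsupp.single (y, x, z) 1 - Finsupp.single (x, z, y) 1 - Finsupp.single (z, y, x) 1) = _
  simp only [map_sub, map_add, AddSubgroup.coe_add, coe_seg]
  simp only [Finsupp.mapDomain.addMonoidHom, AddMonoidHom.coe_mk, ZeroHom.coe_mk,
    Finsupp.mapDomain_single]
  abel

theorem coe_apply_self (c : C1) (a : R3) : (c : R3 × R3 →₀ ℤ) (a, a) = 0 := by
  have := c.2 a a
  omega

open Classical in
/-- Every `1`-chain is an integral combination of segments of nonzero coefficient. -/
theorem exists_eq_sum_segments (c : C1) : ∃ (h : ℕ) (m : Fin h → ℤ) (e : Fin h → OSegment),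
    c = ∑ i, m i • (e i).chain ∧ ∀ i, (c : R3 × R3 →₀ ℤ) ((e i).a, (e i).b) ≠ 0 := by
  -- The coefficient function stores both orientations of a segment; a well-ordering of the points
  -- selects one of them.
  set t : Finset (R3 × R3) :=
    (c : R3 × R3 →₀ ℤ).support.filter (fun q => WellOrderingRel q.1 q.2) with ht
  have hc : c = ∑ q ∈ t, (c : R3 × R3 →₀ ℤ) q • seg q.1 q.2 := by
    apply Subtype.ext
    ext ⟨x, y⟩
    have h1 : ∀ q : R3 × R3, ((seg q.1 q.2 : C1) : R3 × R3 →₀ ℤ) (x, y) =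
        (if q = (x, y) then 1 else 0) - (if q = (y, x) then 1 else 0) := by
      rintro ⟨a, b⟩
      rw [coe_seg, Finsupp.sub_apply, Finsupp.single_apply, Finsupp.single_apply]
      congr 2
      simp only [Prod.mk.injEq, eq_iff_iff]
      tauto
    rw [AddSubgroup.val_finsetSum, Finsupp.finsetSum_apply]
    simp only [AddSubgroup.coe_zsmul, Finsupp.smul_apply, h1, smul_eq_mul, mul_sub, mul_ite,
      mul_one, mul_zero, Finset.sum_sub_distrib, Finset.sum_ite_eq']
    have h2 := c.2 x y
    rcases trichotomous_of WellOrderingRel x y with h | h | h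
    · have h' := asymm_of WellOrderingRel h
      simp only [ht, Finset.mem_filter, Finsupp.mem_support_iff, h, h', and_true, and_false]
      grind
    · subst h
      simp [coe_apply_self]
    · have h' := asymm_of WellOrderingRel h
      simp only [ht, Finset.mem_filter, Finsupp.mem_support_iff, h, h', and_true, and_false]
      grind
  have hne : ∀ q ∈ t, (c : R3 × R3 →₀ ℤ) q ≠ 0 := fun q hq => by
    simpa using (Finset.mem_filter.1 hq).1
  have hne' : ∀ q ∈ t, q.1 ≠ q.2 := by
    rintro ⟨a, b⟩ hq (h : a = b)
    subst h
    exact hne _ hq (coe_apply_self c a)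
  let f := t.equivFin
  refine ⟨t.card, fun i => (c : R3 × R3 →₀ ℤ) (f.symm i),
    fun i => ⟨(f.symm i : R3 × R3).1, (f.symm i : R3 × R3).2, hne' _ (f.symm i).2⟩, ?_,
    fun i => hne _ (f.symm i).2⟩
  conv_lhs => rw [hc]
  rw [← Finset.sum_coe_sort t]
  exact (Equiv.sum_comp f.symm
    (fun q : t => (c : R3 × R3 →₀ ℤ) q • seg (q : R3 × R3).1 (q : R3 × R3).2)).symm

/-- A function on the vertices telescopes to zero along a cycle. -/
theorem sum_sub_eq_zero {ι A : Type*} [AddCommGroup A] (s : Finset ι) (m : ι → ℤ) (a b : ι → R3)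
    (h : bdry1 (∑ i ∈ s, m i • seg (a i) (b i)) = 0) (g : R3 → A) :
    ∑ i ∈ s, m i • (g (b i) - g (a i)) = 0 := by
  -- Extend `g` additively to `0`-chains and evaluate it on the zero boundary.
  have := congrArg (Finsupp.liftAddHom (fun x => zmultiplesHom A (g x))) h
  rw [map_sum, map_sum, map_zero] at this
  rw [← this]
  refine Finset.sum_congr rfl fun i _ => ?_
  rw [map_zsmul, map_zsmul, bdry1_seg, map_sub]
  simp

/-- The `1`-chains with support contained in `Z`. -/
def chains1 (Z : Set R3) : AddSubgroup C1 where
  carrier := {c | supp1 c ⊆ Z}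
  zero_mem' := by
    rintro x ⟨a, b, h, -⟩
    simp at h
  add_mem' := by
    rintro c d hc' hd' x ⟨a, b, h, hx⟩
    by_cases h0 : (c : R3 × R3 →₀ ℤ) (a, b) = 0
    · refine hd' ⟨a, b, ?_, hx⟩
      intro h1
      simp [h0, h1] at h
    · exact hc' ⟨a, b, h0, hx⟩
  neg_mem' := by
    rintro c hc' x ⟨a, b, h, hx⟩
    refine hc' ⟨a, b, ?_, hx⟩
    intro h1
    simp [h1] at h

theorem mem_cycles {Z : Set R3} {c : C1} : c ∈ cycles Z ↔ bdry1 c = 0 ∧ c ∈ chains1 Z := Iff.rfl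

theorem segment_subset_supp1 {c : C1} {a b : R3} (h : (c : R3 × R3 →₀ ℤ) (a, b) ≠ 0) :
    segment ℝ a b ⊆ supp1 c := fun _ hx => ⟨a, b, h, hx⟩

theorem seg_mem_chains1 {Z : Set R3} {a b : R3} (h : segment ℝ a b ⊆ Z) : seg a b ∈ chains1 Z := by
  classical
  rintro x ⟨u, v, hne, hx⟩
  rw [coe_seg, Finsupp.sub_apply, Finsupp.single_apply, Finsupp.single_apply] at hne
  by_cases h1 : (a, b) = (u, v)
  · simp only [Prod.mk.injEq] at h1
    exact h (by rwa [h1.1, h1.2])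
  · by_cases h2 : (b, a) = (u, v)
    · simp only [Prod.mk.injEq] at h2
      exact h (by rwa [segment_symm, h2.1, h2.2])
    · simp [h1, h2] at hne

theorem tri_mem_chains2 {Z : Set R3} {x y z : R3} (h : convexHull ℝ {x, y, z} ⊆ Z) :
    tri x y z ∈ chains2 Z := by
  classical
  intro u v w hne
  have hset : ({u, v, w} : Set R3) = {x, y, z} := by
    by_contra hcon
    apply hne
    have key : ∀ p q r : R3, ({p, q, r} : Set R3) = {x, y, z} →
        (Finsupp.single (p, q, r) (1 : ℤ)) (u, v, w) = 0 := by
      intro p q r hp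
      rw [Finsupp.single_apply, if_neg]
      intro heq
      simp only [Prod.mk.injEq] at heq
      rw [heq.1, heq.2.1, heq.2.2] at hp
      exact hcon hp
    change (Finsupp.single (x, y, z) 1 + Finsupp.single (y, z, x) 1 + Finsupp.single (z, x, y) 1
      - Finsupp.single (y, x, z) 1 - Finsupp.single (x, z, y) 1 - Finsupp.single (z, y, x) 1 :
      R3 × R3 × R3 →₀ ℤ) (u, v, w) = 0
    simp only [Finsupp.sub_apply, Finsupp.add_apply]
    rw [key, key, key, key, key, key]
    · rfl
    all_goals
      ext t
      simp only [Set.mem_insert_iff, Set.mem_singleton_iff] <;> tauto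
  rwa [hset]

/-- The boundary of the cone with apex `w` over a cycle. -/
theorem bdry2_cone {ι : Type*} (s : Finset ι) (m : ι → ℤ) (a b : ι → R3)
    (h : bdry1 (∑ i ∈ s, m i • seg (a i) (b i)) = 0) (w : R3) :
    bdry2 (∑ i ∈ s, m i • tri w (a i) (b i)) = ∑ i ∈ s, m i • seg (a i) (b i) := by
  -- The lateral sides of the cone cancel by telescoping.
  have h0 := sum_sub_eq_zero s m a b h (fun x => seg x w)
  rw [map_sum]
  have : ∀ i ∈ s, bdry2 (m i • tri w (a i) (b i)) =
      m i • seg (a i) (b i) + m i • (seg (b i) w - seg (a i) w) := by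
    intro i _
    rw [map_zsmul, bdry2_tri, ← smul_add, seg_swap (a i) w]
    congr 1
    abel
  rw [Finset.sum_congr rfl this, Finset.sum_add_distrib, h0, add_zero]

/-- Cycles in a convex set bound in it. -/
theorem cycles_le_boundaries {K : Set R3} (hK : Convex ℝ K) : cycles K ≤ boundaries K := by
  intro c hc
  rw [mem_cycles] at hc
  obtain ⟨h, m, e, hsum, hne⟩ := exists_eq_sum_segments c
  -- The apex of the cone will be an end point of the first segment, so the empty sum is set apart.
  by_cases hh : h = 0
  · subst hh
    simp only [Finset.univ_eq_empty, Finset.sum_empty] at hsum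
    rw [hsum]
    exact zero_mem _
  have hseg : ∀ i, segment ℝ (e i).a (e i).b ⊆ K := fun i =>
    (segment_subset_supp1 (hne i)).trans hc.2
  have hw : (e ⟨0, Nat.pos_of_ne_zero hh⟩).a ∈ K := hseg _ (left_mem_segment _ _ _)
  set w := (e ⟨0, Nat.pos_of_ne_zero hh⟩).a
  have hb : bdry1 (∑ i, m i • seg (e i).a (e i).b) = 0 := by
    rw [← hc.1, hsum]
    rfl
  refine ⟨∑ i, m i • tri w (e i).a (e i).b, ?_, ?_⟩
  · refine AddSubgroup.sum_mem _ fun i _ => AddSubgroup.zsmul_mem _ (tri_mem_chains2 ?_) _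
    refine convexHull_min ?_ hK
    rintro x (rfl | rfl | rfl)
    · exact hw
    · exact hseg i (left_mem_segment _ _ _)
    · exact hseg i (right_mem_segment _ _ _)
  · rw [bdry2_cone _ _ _ _ hb, hsum]
    rfl

theorem boundaries_mono {Y Z : Set R3} (h : Y ⊆ Z) : boundaries Y ≤ boundaries Z :=
  AddSubgroup.map_mono fun _ hS x y z hne => (hS x y z hne).trans h

theorem chains1_mono {Y Z : Set R3} (h : Y ⊆ Z) : chains1 Y ≤ chains1 Z :=
  fun _ hc => Set.Subset.trans hc h

theorem homologousIn_iff {Z : Set R3} {c d : C1} :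
    HomologousIn Z c d ↔ c ∈ cycles Z ∧ d ∈ cycles Z ∧ c - d ∈ boundaries Z := by
  constructor
  · rintro ⟨hc, hd, h⟩
    refine ⟨hc, hd, ?_⟩
    have := QuotientAddGroup.eq.1 h
    rw [AddSubgroup.mem_addSubgroupOf] at this
    have h2 := neg_mem this
    simpa [sub_eq_add_neg, add_comm] using h2
  · rintro ⟨hc, hd, h⟩
    refine ⟨hc, hd, QuotientAddGroup.eq.2 ?_⟩
    rw [AddSubgroup.mem_addSubgroupOf]
    have h2 := neg_mem h
    simpa [sub_eq_add_neg, add_comm] using h2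

theorem boundsIn_iff {Z : Set R3} {c : C1} :
    BoundsIn Z c ↔ c ∈ cycles Z ∧ c ∈ boundaries Z := by
  constructor
  · rintro ⟨hc, h⟩
    refine ⟨hc, ?_⟩
    have := (QuotientAddGroup.eq_zero_iff _).1 h
    rwa [AddSubgroup.mem_addSubgroupOf] at this
  · rintro ⟨hc, h⟩
    refine ⟨hc, (QuotientAddGroup.eq_zero_iff _).2 ?_⟩
    rwa [AddSubgroup.mem_addSubgroupOf]

theorem isCompact_supp1 (c : C1) : IsCompact (supp1 c) := by
  have : supp1 c = ⋃ q ∈ (c : R3 × R3 →₀ ℤ).support, segment ℝ q.1 q.2 := by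
    ext x
    simp [supp1]
  rw [this]
  refine Finset.isCompact_biUnion _ fun q _ => ?_
  rw [← convexHull_pair]
  exact (Set.toFinite _).isCompact_convexHull ℝ

/-! ### Crossings of an interval with a polyhedron -/

open Classical in
/-- A segment that enters a polyhedron `{ℓ ≥ 0}` does so through exactly one face, unless it starts
inside of it. -/
theorem sum_entering {ι : Type*} [Fintype ι] (c m : ι → ℝ) (J : Set ℝ)
    (hJ : J = {t | t ∈ Set.Icc (0 : ℝ) 1 ∧ ∀ j, 0 ≤ c j + m j * t})
    (h1 : ∀ t ∈ J, ∀ i j, c i + m i * t = 0 → c j + m j * t = 0 → i = j)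
    (h0 : (0 : ℝ) ∈ J → ∀ j, c j ≠ 0) :
    ∑ j, (if 0 < m j ∧ ∃ t ∈ J, c j + m j * t = 0 then (1 : ℤ) else 0) =
      (if J.Nonempty then 1 else 0) - (if (0 : ℝ) ∈ J then 1 else 0) := by
  by_cases hne : J.Nonempty
  swap
  · have h0' : (0 : ℝ) ∉ J := fun h => hne ⟨0, h⟩
    rw [if_neg hne, if_neg h0', sub_zero]
    refine Finset.sum_eq_zero fun j _ => if_neg ?_
    rintro ⟨-, t, ht, -⟩
    exact hne ⟨t, ht⟩
  rw [if_pos hne]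
  by_cases hz : (0 : ℝ) ∈ J
  · rw [if_pos hz, sub_self]
    refine Finset.sum_eq_zero fun j _ => if_neg ?_
    rintro ⟨hm, t, ht, hzero⟩
    have h2 := h0 hz j
    rw [hJ] at ht hz
    have h3 := hz.2 j
    simp only [mul_zero, add_zero] at h3
    have := mul_nonneg hm.le ht.1.1
    exact h2 (by linarith)
  rw [if_neg hz, sub_zero]
  have hcl : IsClosed {t : ℝ | ∀ j, 0 ≤ c j + m j * t} := by
    rw [Set.ofPred_forall]
    exact isClosed_iInter fun j => isClosed_le continuous_const (by fun_prop)
  have hcomp : IsCompact J := by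
    rw [hJ]
    exact isCompact_Icc.inter_right hcl
  obtain ⟨α, hα, hmin⟩ := hcomp.exists_isLeast hne
  have hα' := hα
  rw [hJ] at hα'
  have hpos : 0 < α := lt_of_le_of_ne hα'.1.1 (by rintro rfl; exact hz hα)
  -- At the entry time `α` some increasing constraint is tight; otherwise all constraints would
  -- still hold slightly before `α`.
  obtain ⟨j₀, hm₀, hj₀⟩ : ∃ j, 0 < m j ∧ c j + m j * α = 0 := by
    by_contra! hcon
    have hev : ∀ᶠ t in nhdsWithin α (Set.Iio α), ∀ j, 0 ≤ c j + m j * t := by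
      rw [Filter.eventually_all]
      intro j
      rcases lt_or_ge 0 (m j) with hj | hj
      · have h4 : 0 < c j + m j * α := lt_of_le_of_ne (hα'.2 j) (hcon j hj).symm
        have hcont : Filter.Tendsto (fun t => c j + m j * t) (nhdsWithin α (Set.Iio α))
            (nhds (c j + m j * α)) :=
          ((by fun_prop : Continuous fun t : ℝ => c j + m j * t).tendsto α).mono_left
            nhdsWithin_le_nhds
        exact (hcont.eventually (lt_mem_nhds h4)).mono fun t ht => ht.le
      · filter_upwards [self_mem_nhdsWithin] with t ht
        have h5 := hα'.2 j
        have h6 : t < α := ht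
        nlinarith
    have hev2 : ∀ᶠ t in nhdsWithin α (Set.Iio α), 0 < t :=
      (lt_mem_nhds hpos).filter_mono nhdsWithin_le_nhds
    obtain ⟨t, ht1, ht2, ht3⟩ := (hev.and (hev2.and self_mem_nhdsWithin)).exists
    have h7 : t < α := ht3
    have : t ∈ J := by
      rw [hJ]
      exact ⟨⟨ht2.le, h7.le.trans hα'.1.2⟩, ht1⟩
    exact absurd (hmin this) (not_le.2 h7)
  rw [Finset.sum_eq_single j₀]
  · exact if_pos ⟨hm₀, α, hα, hj₀⟩
  · intro j _ hj
    refine if_neg ?_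
    rintro ⟨hm, t, ht, hzero⟩
    apply hj
    have h8 := hmin ht
    have h9 := hα'.2 j
    -- An increasing constraint that vanishes at some `t ≥ α` is already nonpositive at `α`, so it
    -- is tight there and coincides with `j₀`.
    refine h1 α hα j j₀ (le_antisymm ?_ h9) hj₀
    nlinarith
  · intro h
    exact absurd (Finset.mem_univ _) h

open Classical in
/-- The signed number of crossings of a segment with the faces of a polyhedron `{ℓ ≥ 0}`. -/
theorem sum_crossings {ι : Type*} [Fintype ι] (c m : ι → ℝ) (J : Set ℝ)
    (hJ : J = {t | t ∈ Set.Icc (0 : ℝ) 1 ∧ ∀ j, 0 ≤ c j + m j * t})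
    (h1 : ∀ t ∈ J, ∀ i j, c i + m i * t = 0 → c j + m j * t = 0 → i = j)
    (h0 : (0 : ℝ) ∈ J → ∀ j, c j ≠ 0) (h0' : (1 : ℝ) ∈ J → ∀ j, c j + m j ≠ 0) :
    ∑ j, (if ∃ t ∈ J, c j + m j * t = 0 then (SignType.sign (m j) : ℤ) else 0) =
      (if (1 : ℝ) ∈ J then 1 else 0) - (if (0 : ℝ) ∈ J then 1 else 0) := by
  have e1 := sum_entering c m J hJ h1 h0
  -- Exits are entries of the reversed segment.
  set J' : Set ℝ := {t | 1 - t ∈ J} with hJ'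
  have e2 := sum_entering (fun j => c j + m j) (fun j => -m j) J' (by
      ext t
      simp only [hJ', hJ, Set.mem_ofPred_eq, Set.mem_Icc]
      refine and_congr ⟨fun h => ⟨by linarith [h.2], by linarith [h.1]⟩,
        fun h => ⟨by linarith [h.2], by linarith [h.1]⟩⟩ (forall_congr' fun j => ?_)
      rw [show c j + m j * (1 - t) = c j + m j + -m j * t by ring])
    (fun t ht i j hi hj => h1 (1 - t) ht i j (by linarith) (by linarith))
    (fun h => h0' (by simpa [hJ'] using h))
  have hn : J'.Nonempty ↔ J.Nonempty :=
    ⟨fun ⟨t, ht⟩ => ⟨1 - t, ht⟩, fun ⟨t, ht⟩ => ⟨1 - t, by simpa [hJ'] using ht⟩⟩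
  have hz : (0 : ℝ) ∈ J' ↔ (1 : ℝ) ∈ J := by simp [hJ']
  simp only [hn, hz] at e2
  have e3 : (if (1 : ℝ) ∈ J then (1 : ℤ) else 0) - (if (0 : ℝ) ∈ J then 1 else 0) =
      ∑ j, (if 0 < m j ∧ ∃ t ∈ J, c j + m j * t = 0 then (1 : ℤ) else 0) -
      ∑ j, (if 0 < -m j ∧ ∃ t ∈ J', c j + m j + -m j * t = 0 then (1 : ℤ) else 0) := by
    rw [e1, e2]
    ring
  rw [e3, ← Finset.sum_sub_distrib]
  refine Finset.sum_congr rfl fun j _ => ?_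
  have hex : (∃ t ∈ J', c j + m j + -m j * t = 0) ↔ ∃ t ∈ J, c j + m j * t = 0 :=
    ⟨fun ⟨t, ht, h⟩ => ⟨1 - t, ht, by linarith⟩,
      fun ⟨t, ht, h⟩ => ⟨1 - t, by simpa [hJ'] using ht, by linarith⟩⟩
  rw [hex]
  by_cases h : ∃ t ∈ J, c j + m j * t = 0
  · rcases lt_trichotomy (m j) 0 with hm | hm | hm
    · simp [h, hm, hm.not_gt]
    · simp [hm]
    · simp [h, hm, hm.not_gt]
  · simp [h]

/-! ### The crossing form in a direction `w` -/

/-- The determinant of three vectors. -/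
def det3 (u v w : R3) : ℝ := u ⬝ᵥ (v ⨯₃ w)

theorem det3_apply (u v w : R3) : det3 u v w =
    u 0 * (v 1 * w 2 - v 2 * w 1) + u 1 * (v 2 * w 0 - v 0 * w 2) +
      u 2 * (v 0 * w 1 - v 1 * w 0) := by
  simp [det3, cross_apply, dotProduct, Fin.sum_univ_three]

open Classical in
/-- The signed crossing of `[a, b]` with the half strip `[x, y] + [0, ∞) w`. -/
def crossing (w a b x y : R3) : ℤ :=
  if ∃ p ∈ segment ℝ a b, ∃ t : ℝ, 0 ≤ t ∧ p - t • w ∈ segment ℝ x y then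
    (SignType.sign (det3 (b - a) (y - x) w) : ℤ) else 0

open Classical in
/-- The signed indicator function of the half prism `[x, y, z] + [0, ∞) w`. -/
def prismIndex (w x y z p : R3) : ℤ :=
  if ∃ t : ℝ, 0 ≤ t ∧ p - t • w ∈ convexHull ℝ {x, y, z} then
    (SignType.sign (det3 (y - x) (z - x) w) : ℤ) else 0

theorem crossing_swap_left (w a b x y : R3) : crossing w b a x y = -crossing w a b x y := by
  unfold crossing
  rw [segment_symm ℝ b a, show det3 (a - b) (y - x) w = -det3 (b - a) (y - x) w by
    simp only [det3_apply, Pi.sub_apply]; ring, Left.sign_neg]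
  split_ifs
  · cases SignType.sign (det3 (b - a) (y - x) w) <;> rfl
  · rfl

/-- Going up along `w` from one segment to the other is going down in the opposite order, and the
determinant changes sign twice. This transfers every statement about one argument to the other. -/
theorem crossing_comm (w a b x y : R3) : crossing w a b x y = crossing (-w) x y a b := by
  unfold crossing
  rw [show det3 (y - x) (b - a) (-w) = det3 (b - a) (y - x) w by
    simp only [det3_apply, Pi.sub_apply, Pi.neg_apply]; ring]
  congr 1
  refine propext ⟨?_, ?_⟩
  · rintro ⟨p, hp, t, ht, h⟩
    exact ⟨_, h, t, ht, by simpa using hp⟩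
  · rintro ⟨p, hp, t, ht, h⟩
    exact ⟨_, h, t, ht, by simpa using hp⟩

theorem crossing_swap_right (w a b x y : R3) : crossing w a b y x = -crossing w a b x y := by
  rw [crossing_comm, crossing_swap_left, ← crossing_comm]

/-! ### Coordinates adapted to a half prism -/

theorem mem_convexHull_triple {x y z p : R3} : p ∈ convexHull ℝ {x, y, z} ↔
    ∃ α β γ : ℝ, 0 ≤ α ∧ 0 ≤ β ∧ 0 ≤ γ ∧ α + β + γ = 1 ∧ p = α • x + β • y + γ • z := by
  constructor
  · rw [convexHull_insert (Set.insert_nonempty _ _), convexHull_pair, mem_convexJoin]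
    rintro ⟨u, rfl, v, ⟨a, b, ha, hb, hab, rfl⟩, ⟨c, d, hc, hd, hcd, rfl⟩⟩
    refine ⟨c, d * a, d * b, hc, mul_nonneg hd ha, mul_nonneg hd hb, ?_, ?_⟩
    · rw [add_assoc, ← mul_add, hab, mul_one, hcd]
    · rw [smul_add, smul_smul, smul_smul, add_assoc]
  · rintro ⟨α, β, γ, ha, hb, hc, h, rfl⟩
    have hx : x ∈ convexHull ℝ ({x, y, z} : Set R3) := subset_convexHull ℝ _ (by simp)
    have hy : y ∈ convexHull ℝ ({x, y, z} : Set R3) := subset_convexHull ℝ _ (by simp)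
    have hz : z ∈ convexHull ℝ ({x, y, z} : Set R3) := subset_convexHull ℝ _ (by simp)
    have := (convex_convexHull ℝ ({x, y, z} : Set R3)).sum_mem (t := Finset.univ)
      (w := ![α, β, γ]) (z := ![x, y, z]) (by
        intro i _
        fin_cases i <;> simpa) (by simpa [Fin.sum_univ_three] using h) (by
        intro i _
        fin_cases i <;> simpa)
    simpa [Fin.sum_univ_three] using this

/-- The coordinates of `p` with respect to the triangle `[x, y, z]` and the direction `w`. -/
def prismCoord (w x y z p : R3) : Fin 4 → ℝ :=
  ![1 - det3 (p - x) (z - x) w / det3 (y - x) (z - x) w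
      - det3 (y - x) (p - x) w / det3 (y - x) (z - x) w,
    det3 (p - x) (z - x) w / det3 (y - x) (z - x) w,
    det3 (y - x) (p - x) w / det3 (y - x) (z - x) w,
    det3 (y - x) (z - x) (p - x) / det3 (y - x) (z - x) w]

/-- Cramer's rule: the first three entries are barycentric coordinates of the projection along `w`,
the last is the height. -/
theorem prismCoord_eq_iff {w x y z : R3} (hD : det3 (y - x) (z - x) w ≠ 0) (p : R3)
    {α β γ h : ℝ} (hs : α + β + γ = 1) :
    p = α • x + β • y + γ • z + h • w ↔ prismCoord w x y z p = ![α, β, γ, h] := by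
  constructor
  · rintro rfl
    have hα : α = 1 - β - γ := by linarith
    subst hα
    have e1 : det3 ((1 - β - γ) • x + β • y + γ • z + h • w - x) (z - x) w =
        β * det3 (y - x) (z - x) w := by
      simp only [det3_apply, Pi.sub_apply, Pi.add_apply, Pi.smul_apply, smul_eq_mul]; ring
    have e2 : det3 (y - x) ((1 - β - γ) • x + β • y + γ • z + h • w - x) w =
        γ * det3 (y - x) (z - x) w := by
      simp only [det3_apply, Pi.sub_apply, Pi.add_apply, Pi.smul_apply, smul_eq_mul]; ring
    have e3 : det3 (y - x) (z - x) ((1 - β - γ) • x + β • y + γ • z + h • w - x) =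
        h * det3 (y - x) (z - x) w := by
      simp only [det3_apply, Pi.sub_apply, Pi.add_apply, Pi.smul_apply, smul_eq_mul]; ring
    rw [prismCoord, e1, e2, e3, mul_div_cancel_right₀ _ hD, mul_div_cancel_right₀ _ hD,
      mul_div_cancel_right₀ _ hD]
  · intro hp
    have h0 := congrFun hp 0
    have h1 := congrFun hp 1
    have h2 := congrFun hp 2
    have h3 := congrFun hp 3
    simp only [prismCoord, Matrix.cons_val] at h0 h1 h2 h3
    rw [div_eq_iff hD] at h1 h2 h3
    have key : ∀ i, (det3 (y - x) (z - x) w) * (p i - x i) =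
        det3 (p - x) (z - x) w * (y i - x i) + det3 (y - x) (p - x) w * (z i - x i) +
        det3 (y - x) (z - x) (p - x) * w i := by
      intro i
      fin_cases i <;> simp only [det3_apply, Pi.sub_apply, Fin.zero_eta, Fin.mk_one,
        Fin.reduceFinMk] <;> ring
    ext i
    have hi := key i
    rw [h1, h2, h3] at hi
    have hα : α = 1 - β - γ := by linarith
    have : p i - x i = β * (y i - x i) + γ * (z i - x i) + h * w i := by
      apply mul_left_cancel₀ hD
      rw [hi]
      ring
    simp only [Pi.add_apply, Pi.smul_apply, smul_eq_mul, hα]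
    linarith

theorem prismCoord_sum (w x y z p : R3) :
    prismCoord w x y z p 0 + prismCoord w x y z p 1 + prismCoord w x y z p 2 = 1 := by
  simp only [prismCoord, Matrix.cons_val]
  ring

theorem eq_prismCoord {w x y z : R3} (hD : det3 (y - x) (z - x) w ≠ 0) (p : R3) :
    p = prismCoord w x y z p 0 • x + prismCoord w x y z p 1 • y + prismCoord w x y z p 2 • z +
      prismCoord w x y z p 3 • w := by
  rw [prismCoord_eq_iff hD p (prismCoord_sum w x y z p)]
  ext j
  fin_cases j <;> rfl

/-- The coordinates are affine in the point, which gives the constraints the form that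
`sum_crossings` expects. -/
theorem prismCoord_line (w x y z a b : R3) (t : ℝ) (j : Fin 4) :
    prismCoord w x y z (a + t • (b - a)) j =
      prismCoord w x y z a j + (prismCoord w x y z b j - prismCoord w x y z a j) * t := by
  fin_cases j <;> simp only [prismCoord, Matrix.cons_val, det3_apply, Pi.sub_apply, Pi.add_apply,
    Pi.smul_apply, smul_eq_mul, Fin.zero_eta, Fin.mk_one, Fin.reduceFinMk] <;> ring

theorem mem_convexHull_iff_prismCoord {w x y z : R3} (hD : det3 (y - x) (z - x) w ≠ 0) (p : R3) :
    p ∈ convexHull ℝ {x, y, z} ↔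
      (∀ j, 0 ≤ prismCoord w x y z p j) ∧ prismCoord w x y z p 3 = 0 := by
  rw [mem_convexHull_triple]
  constructor
  · rintro ⟨α, β, γ, ha, hb, hc, hs, hp⟩
    have : p = α • x + β • y + γ • z + (0 : ℝ) • w := by rw [hp, zero_smul, add_zero]
    rw [prismCoord_eq_iff hD p hs] at this
    rw [this]
    exact ⟨fun j => by fin_cases j <;> simp [ha, hb, hc], rfl⟩
  · rintro ⟨h, h3⟩
    have := eq_prismCoord hD p
    rw [h3, zero_smul, add_zero] at this
    exact ⟨_, _, _, h 0, h 1, h 2, prismCoord_sum w x y z p, this⟩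

theorem mem_prism_iff_prismCoord {w x y z : R3} (hD : det3 (y - x) (z - x) w ≠ 0) (p : R3) :
    (∃ t : ℝ, 0 ≤ t ∧ p - t • w ∈ convexHull ℝ {x, y, z}) ↔ ∀ j, 0 ≤ prismCoord w x y z p j := by
  constructor
  · rintro ⟨t, ht, h⟩
    obtain ⟨α, β, γ, ha, hb, hc, hs, hp⟩ := mem_convexHull_triple.1 h
    have : p = α • x + β • y + γ • z + t • w := by rw [← hp, sub_add_cancel]
    rw [prismCoord_eq_iff hD p hs] at this
    rw [this]
    exact fun j => by fin_cases j <;> simp [ha, hb, hc, ht]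
  · intro h
    refine ⟨_, h 3, mem_convexHull_triple.2 ⟨_, _, _, h 0, h 1, h 2, prismCoord_sum w x y z p, ?_⟩⟩
    rw [sub_eq_iff_eq_add]
    exact eq_prismCoord hD p

/-- A vanishing barycentric coordinate singles out the face of the half prism over the side opposite
to that vertex. -/
theorem mem_strip_iff_prismCoord {w x y z : R3} (hD : det3 (y - x) (z - x) w ≠ 0) (p : R3) :
    ((∃ t : ℝ, 0 ≤ t ∧ p - t • w ∈ segment ℝ y z) ↔
      (∀ j, 0 ≤ prismCoord w x y z p j) ∧ prismCoord w x y z p 0 = 0) ∧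
    ((∃ t : ℝ, 0 ≤ t ∧ p - t • w ∈ segment ℝ z x) ↔
      (∀ j, 0 ≤ prismCoord w x y z p j) ∧ prismCoord w x y z p 1 = 0) ∧
    ((∃ t : ℝ, 0 ≤ t ∧ p - t • w ∈ segment ℝ x y) ↔
      (∀ j, 0 ≤ prismCoord w x y z p j) ∧ prismCoord w x y z p 2 = 0) := by
  have key : ∀ α β γ t : ℝ, α + β + γ = 1 → 0 ≤ α → 0 ≤ β → 0 ≤ γ → 0 ≤ t →
      p = α • x + β • y + γ • z + t • w → (∀ j, 0 ≤ prismCoord w x y z p j) ∧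
      prismCoord w x y z p 0 = α ∧ prismCoord w x y z p 1 = β ∧ prismCoord w x y z p 2 = γ := by
    intro α β γ t hs ha hb hc ht hp
    rw [prismCoord_eq_iff hD p hs] at hp
    rw [hp]
    exact ⟨fun j => by fin_cases j <;> simp [ha, hb, hc, ht], rfl, rfl, rfl⟩
  have hsum := prismCoord_sum w x y z p
  have hp := eq_prismCoord hD p
  refine ⟨⟨?_, ?_⟩, ⟨?_, ?_⟩, ⟨?_, ?_⟩⟩
  · rintro ⟨t, ht, α, β, ha, hb, hs, h⟩
    have := key 0 α β t (by linarith) le_rfl ha hb ht (by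
      rw [zero_smul, zero_add, h, sub_add_cancel])
    exact ⟨this.1, this.2.1⟩
  · rintro ⟨h, h0⟩
    rw [h0, zero_smul, zero_add] at hp
    exact ⟨_, h 3, _, _, h 1, h 2, by linarith, (sub_eq_iff_eq_add.2 hp).symm⟩
  · rintro ⟨t, ht, α, β, ha, hb, hs, h⟩
    have := key β 0 α t (by linarith) hb le_rfl ha ht (by
      rw [zero_smul, add_zero, add_comm (β • x), h, sub_add_cancel])
    exact ⟨this.1, this.2.2.1⟩
  · rintro ⟨h, h0⟩
    rw [h0, zero_smul, add_zero, add_comm (_ • x)] at hp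
    exact ⟨_, h 3, _, _, h 2, h 0, by linarith, (sub_eq_iff_eq_add.2 hp).symm⟩
  · rintro ⟨t, ht, α, β, ha, hb, hs, h⟩
    have := key α β 0 t (by linarith) ha hb le_rfl ht (by
      rw [zero_smul, add_zero, h, sub_add_cancel])
    exact ⟨this.1, this.2.2.2⟩
  · rintro ⟨h, h0⟩
    rw [h0, zero_smul, add_zero] at hp
    exact ⟨_, h 3, _, _, h 0, h 1, by linarith, (sub_eq_iff_eq_add.2 hp).symm⟩

theorem sign_div_cast (u v : ℝ) : ((SignType.sign (u / v) : SignType) : ℤ) =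
    (SignType.sign v : ℤ) * (SignType.sign u : ℤ) := by
  rcases lt_trichotomy v 0 with hv | rfl | hv
  · rcases lt_trichotomy u 0 with hu | rfl | hu
    · rw [sign_pos (div_pos_of_neg_of_neg hu hv), sign_neg hu, sign_neg hv]; rfl
    · simp
    · rw [sign_neg (div_neg_of_pos_of_neg hu hv), sign_pos hu, sign_neg hv]; rfl
  · simp
  · rcases lt_trichotomy u 0 with hu | rfl | hu
    · rw [sign_neg (div_neg_of_neg_of_pos hu hv), sign_neg hu, sign_pos hv]; rfl
    · simp
    · rw [sign_pos (div_pos hu hv), sign_pos hu, sign_pos hv]; rfl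

theorem sign_cast_mul_self {v : ℝ} (hv : v ≠ 0) :
    (SignType.sign v : ℤ) * (SignType.sign v : ℤ) = 1 := by
  rcases lt_or_gt_of_ne hv with hv | hv
  · rw [sign_neg hv]; rfl
  · rw [sign_pos hv]; rfl

theorem sign_neg_cast (v : ℝ) : ((SignType.sign (-v) : SignType) : ℤ) = -(SignType.sign v : ℤ) := by
  rw [Left.sign_neg]
  cases SignType.sign v <;> rfl

open Classical in
/-- The crossings of a segment with the boundary of the half prism over a triangle. -/
theorem crossing_bdry_triangle {w a b x y z : R3} (hD : det3 (y - x) (z - x) w ≠ 0)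
    (hv : ∀ v ∈ ({x, y, z} : Set R3), ∀ p ∈ segment ℝ a b, ∀ t : ℝ, 0 ≤ t → p - t • w ≠ v)
    (he : ∀ q ∈ ({a, b} : Set R3), ∀ t : ℝ, 0 ≤ t →
      q - t • w ∉ segment ℝ x y ∪ segment ℝ y z ∪ segment ℝ z x)
    (ha : a ∉ convexHull ℝ {x, y, z}) (hb : b ∉ convexHull ℝ {x, y, z})
    (hs : ∀ p ∈ segment ℝ a b, p ∉ segment ℝ x y ∪ segment ℝ y z ∪ segment ℝ z x) :
    (if ∃ p ∈ segment ℝ a b, p ∈ convexHull ℝ {x, y, z} then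
      (SignType.sign (det3 (b - a) (y - x) (z - x)) : ℤ) else 0) =
    crossing w a b y z + crossing w a b z x + crossing w a b x y +
      (prismIndex w x y z b - prismIndex w x y z a) := by
  set co := prismCoord w x y z with hco
  set D := det3 (y - x) (z - x) w with hDdef
  set J : Set ℝ := {t | t ∈ Set.Icc (0 : ℝ) 1 ∧ ∀ j, 0 ≤ co a j + (co b j - co a j) * t} with hJ
  have hline : ∀ (t : ℝ) (j : Fin 4), co a j + (co b j - co a j) * t = co (a + t • (b - a)) j :=
    fun t j => (prismCoord_line w x y z a b t j).symm
  have hJ' : ∀ t, t ∈ J ↔ t ∈ Set.Icc (0 : ℝ) 1 ∧ ∀ j, 0 ≤ co (a + t • (b - a)) j := by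
    intro t
    simp only [hJ, Set.mem_ofPred_eq, hline]
  have hseg : ∀ p, p ∈ segment ℝ a b ↔ ∃ t ∈ Set.Icc (0 : ℝ) 1, a + t • (b - a) = p := by
    intro p
    rw [segment_eq_image']
    rfl
  have hstrip := fun p => mem_strip_iff_prismCoord hD p
  have hex : ∀ j, (∃ t ∈ J, co a j + (co b j - co a j) * t = 0) ↔
      ∃ p ∈ segment ℝ a b, (∀ i, 0 ≤ co p i) ∧ co p j = 0 := by
    intro j
    constructor
    · rintro ⟨t, ht, h⟩
      rw [hJ'] at ht
      exact ⟨_, (hseg _).2 ⟨t, ht.1, rfl⟩, ht.2, by rw [← hline]; exact h⟩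
    · rintro ⟨p, hp, h, h'⟩
      obtain ⟨t, ht, rfl⟩ := (hseg p).1 hp
      exact ⟨t, (hJ' t).2 ⟨ht, h⟩, by rw [hline]; exact h'⟩
  have ht1 : (1 : ℝ) ∈ J ↔ ∀ j, 0 ≤ co b j := by
    rw [hJ']
    simp
  have ht0 : (0 : ℝ) ∈ J ↔ ∀ j, 0 ≤ co a j := by
    rw [hJ']
    simp
  have hend : ∀ q ∈ ({a, b} : Set R3), q ∉ convexHull ℝ {x, y, z} → (∀ j, 0 ≤ co q j) →
      ∀ j, co q j ≠ 0 := by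
    intro q hq hq' h j hj
    have h' := he q hq
    simp only [Set.mem_union, not_or] at h'
    fin_cases j
    · obtain ⟨t, ht, h2⟩ := (hstrip q).1.2 ⟨h, hj⟩
      exact (h' t ht).1.2 h2
    · obtain ⟨t, ht, h2⟩ := (hstrip q).2.1.2 ⟨h, hj⟩
      exact (h' t ht).2 h2
    · obtain ⟨t, ht, h2⟩ := (hstrip q).2.2.2 ⟨h, hj⟩
      exact (h' t ht).1.1 h2
    · exact hq' ((mem_convexHull_iff_prismCoord hD q).2 ⟨h, hj⟩)
  -- Two faces of the half prism meet in a ray over a vertex or in a side of the triangle; `hv` and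
  -- `hs` exclude both.
  have htie : ∀ p ∈ segment ℝ a b, (∀ j, 0 ≤ co p j) → ∀ i j, co p i = 0 → co p j = 0 → i = j := by
    intro p hp h
    have hpe : p = co p 0 • x + co p 1 • y + co p 2 • z + co p 3 • w := eq_prismCoord hD p
    have hsum : co p 0 + co p 1 + co p 2 = 1 := prismCoord_sum w x y z p
    have hv' : ∀ v ∈ ({x, y, z} : Set R3), p ≠ v + co p 3 • w := fun v hv1 h2 =>
      hv v hv1 p hp _ (h 3) (by rw [sub_eq_iff_eq_add]; exact h2)
    have hs' := hs p hp
    simp only [Set.mem_union, not_or] at hs'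
    have f01 : co p 0 = 0 → co p 1 = 0 → False := by
      intro h0 h1
      refine hv' z (by simp) ?_
      rw [h0, h1, show co p 2 = 1 by linarith] at hpe
      simpa using hpe
    have f02 : co p 0 = 0 → co p 2 = 0 → False := by
      intro h0 h1
      refine hv' y (by simp) ?_
      rw [h0, h1, show co p 1 = 1 by linarith] at hpe
      simpa using hpe
    have f12 : co p 1 = 0 → co p 2 = 0 → False := by
      intro h0 h1
      refine hv' x (by simp) ?_
      rw [h0, h1, show co p 0 = 1 by linarith] at hpe
      simpa using hpe
    have f03 : co p 0 = 0 → co p 3 = 0 → False := by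
      intro h0 h1
      refine hs'.1.2 ⟨_, _, h 1, h 2, by linarith, ?_⟩
      rw [h0, h1] at hpe
      simpa using hpe.symm
    have f13 : co p 1 = 0 → co p 3 = 0 → False := by
      intro h0 h1
      refine hs'.2 ⟨_, _, h 2, h 0, by linarith, ?_⟩
      rw [h0, h1] at hpe
      rw [add_comm]
      simpa using hpe.symm
    have f23 : co p 2 = 0 → co p 3 = 0 → False := by
      intro h0 h1
      refine hs'.1.1 ⟨_, _, h 0, h 1, by linarith, ?_⟩
      rw [h0, h1] at hpe
      simpa using hpe.symm
    intro i j hi hj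
    fin_cases i <;> fin_cases j <;> first
      | rfl
      | exact (f01 hi hj).elim | exact (f01 hj hi).elim
      | exact (f02 hi hj).elim | exact (f02 hj hi).elim
      | exact (f12 hi hj).elim | exact (f12 hj hi).elim
      | exact (f03 hi hj).elim | exact (f03 hj hi).elim
      | exact (f13 hi hj).elim | exact (f13 hj hi).elim
      | exact (f23 hi hj).elim | exact (f23 hj hi).elim
  have main := sum_crossings (co a) (fun j => co b j - co a j) J hJ
    (fun t ht i j hi hj => by
      rw [hJ'] at ht
      exact htie _ ((hseg _).2 ⟨t, ht.1, rfl⟩) ht.2 i j (by rw [← hline]; exact hi)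
        (by rw [← hline]; exact hj))
    (fun h => hend a (by simp) ha (ht0.1 h))
    (fun h j => by
      rw [add_sub_cancel]
      exact hend b (by simp) hb (ht1.1 h) j)
  simp only [hex, ht1, ht0, Fin.sum_univ_four] at main
  -- Up to the sign of `D`, the slopes of the four coordinates have the signs that occur in the
  -- crossings with the three strips (negated) and with the triangle.
  have s0 : co b 0 - co a 0 = -det3 (b - a) (z - y) w / D := by
    simp only [hco, prismCoord, Matrix.cons_val, ← hDdef, det3_apply, Pi.sub_apply]
    ring
  have s1 : co b 1 - co a 1 = -det3 (b - a) (x - z) w / D := by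
    simp only [hco, prismCoord, Matrix.cons_val, ← hDdef, det3_apply, Pi.sub_apply]
    ring
  have s2 : co b 2 - co a 2 = -det3 (b - a) (y - x) w / D := by
    simp only [hco, prismCoord, Matrix.cons_val, ← hDdef, det3_apply, Pi.sub_apply]
    ring
  have s3 : co b 3 - co a 3 = det3 (b - a) (y - x) (z - x) / D := by
    simp only [hco, prismCoord, Matrix.cons_val, ← hDdef, det3_apply, Pi.sub_apply]
    ring
  rw [s0, s1, s2, s3] at main
  simp only [sign_div_cast, sign_neg_cast] at main
  simp only [crossing, prismIndex, (hstrip _).1, (hstrip _).2.1, (hstrip _).2.2,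
    mem_prism_iff_prismCoord hD, ← hDdef, ← hco]
  simp only [mem_convexHull_iff_prismCoord hD, ← hco]
  have hDD := sign_cast_mul_self hD
  set s : ℤ := (SignType.sign D : ℤ)
  -- Multiplying by the sign of `D` removes it from the slopes and turns the indicator of the prism
  -- into `prismIndex`.
  have main' := congrArg (fun n => s * n) main
  simp only [mul_sub, mul_add, mul_ite, mul_one, mul_zero, mul_neg, ← mul_assoc, hDD,
    one_mul] at main'
  split_ifs at main' ⊢ <;> linarith

/-! ### Generic directions -/

/-- The direction `w` is not parallel to any plane or line spanned by points of `V`. -/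
def IsGeneric (V : Set R3) (w : R3) : Prop :=
  ∀ p ∈ V, ∀ q ∈ V, ∀ r ∈ V, w ∉ Submodule.span ℝ {q - p, r - p}

theorem span_pair_ne_top (u v : R3) : Submodule.span ℝ {u, v} ≠ ⊤ := by
  classical
  intro h
  have h1 := finrank_span_finset_le_card (R := ℝ) ({u, v} : Finset R3)
  have h2 : ({u, v} : Finset R3).card ≤ 2 := Finset.card_le_two
  unfold Set.finrank at h1
  rw [Finset.coe_pair, h, finrank_top, Module.finrank_fin_fun] at h1
  omega

/-- Only finitely many proper subspaces are excluded, and each of them is null. -/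
theorem ae_isGeneric {V : Set R3} (hV : V.Finite) :
    ∀ᵐ w : R3 ∂MeasureTheory.volume, IsGeneric V w := by
  have hc := hV.countable
  unfold IsGeneric
  rw [MeasureTheory.ae_ball_iff hc]
  intro p _
  rw [MeasureTheory.ae_ball_iff hc]
  intro q _
  rw [MeasureTheory.ae_ball_iff hc]
  intro r _
  have := MeasureTheory.Measure.addHaar_submodule (MeasureTheory.volume : MeasureTheory.Measure R3)
    _ (span_pair_ne_top (q - p) (r - p))
  exact MeasureTheory.measure_eq_zero_iff_ae_notMem.1 this

/-- Otherwise `w` would be a combination of `q - p` and `r - p`. Both signs of `t` are needed: end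
points of a segment are moved down onto sides of a triangle, vertices of the triangle up onto the
segment. -/
theorem IsGeneric.sub_smul_notMem {V : Set R3} {w : R3} (hw : IsGeneric V w) {p q r : R3}
    (hp : p ∈ V) (hq : q ∈ V) (hr : r ∈ V) {t : ℝ} (ht : t ≠ 0) :
    p - t • w ∉ segment ℝ q r := by
  rintro ⟨α, β, -, -, h, h'⟩
  refine hw p hp q hq r hr (Submodule.mem_span_pair.2 ⟨-(t⁻¹ * α), -(t⁻¹ * β), ?_⟩)
  have hα : α = 1 - β := by linarith
  subst hα
  ext i
  have hi := congrFun h' i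
  simp only [Pi.add_apply, Pi.smul_apply, Pi.sub_apply, smul_eq_mul] at hi ⊢
  field_simp
  linarith

/-- Expand `w` in the basis `u`, `v`, `u ⨯₃ v`: the last coefficient is a multiple of the
determinant, so a zero determinant would put `w` in the span. -/
theorem det3_ne_zero {u v w : R3} (h : u ⨯₃ v ≠ 0) (hw : w ∉ Submodule.span ℝ {u, v}) :
    det3 u v w ≠ 0 := by
  intro h0
  set n := u ⨯₃ v with hn
  have hnn : n ⬝ᵥ n ≠ 0 := fun h1 => h (dotProduct_self_eq_zero.1 h1)
  apply hw
  refine Submodule.mem_span_pair.2 ⟨(n ⬝ᵥ n)⁻¹ * (n ⬝ᵥ (w ⨯₃ v)), (n ⬝ᵥ n)⁻¹ * (n ⬝ᵥ (u ⨯₃ w)), ?_⟩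
  have key : (n ⬝ᵥ (w ⨯₃ v)) • u + (n ⬝ᵥ (u ⨯₃ w)) • v + det3 u v w • n = (n ⬝ᵥ n) • w := by
    ext i
    fin_cases i <;> simp [hn, det3_apply, cross_apply, dotProduct, Fin.sum_univ_three] <;> ring
  rw [h0, zero_smul, add_zero] at key
  rw [mul_smul, mul_smul, ← smul_add, key, smul_smul, inv_mul_cancel₀ hnn, one_smul]

theorem segments_subset_convexHull (x y z : R3) :
    segment ℝ x y ∪ segment ℝ y z ∪ segment ℝ z x ⊆ convexHull ℝ {x, y, z} := by
  have hx : x ∈ convexHull ℝ ({x, y, z} : Set R3) := subset_convexHull ℝ _ (by simp)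
  have hy : y ∈ convexHull ℝ ({x, y, z} : Set R3) := subset_convexHull ℝ _ (by simp)
  have hz : z ∈ convexHull ℝ ({x, y, z} : Set R3) := subset_convexHull ℝ _ (by simp)
  have hc := convex_convexHull ℝ ({x, y, z} : Set R3)
  exact Set.union_subset (Set.union_subset (hc.segment_subset hx hy) (hc.segment_subset hy hz))
    (hc.segment_subset hz hx)

open Classical in
-- Degenerate incidences at height `t = 0` are ruled out by `hd`, those at `t > 0` by genericity of
-- `w`.
theorem crossing_bdry_triangle_of_generic {V : Set R3} {w a b x y z : R3} (hw : IsGeneric V w)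
    (ha : a ∈ V) (hb : b ∈ V) (hx : x ∈ V) (hy : y ∈ V) (hz : z ∈ V)
    (hn : (y - x) ⨯₃ (z - x) ≠ 0)
    (hd : ∀ p ∈ segment ℝ a b ∩ convexHull ℝ {x, y, z},
      p ∉ ({a, b} : Set R3) ∪ (segment ℝ x y ∪ segment ℝ y z ∪ segment ℝ z x)) :
    (if ∃ p ∈ segment ℝ a b, p ∈ convexHull ℝ {x, y, z} then
      (SignType.sign (det3 (b - a) (y - x) (z - x)) : ℤ) else 0) =
    crossing w a b y z + crossing w a b z x + crossing w a b x y +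
      (prismIndex w x y z b - prismIndex w x y z a) := by
  have hsub := segments_subset_convexHull x y z
  have hd1 : ∀ p ∈ segment ℝ a b, p ∉ segment ℝ x y ∪ segment ℝ y z ∪ segment ℝ z x :=
    fun p hp hp' => hd p ⟨hp, hsub hp'⟩ (Or.inr hp')
  have hd2 : ∀ q ∈ ({a, b} : Set R3), q ∉ convexHull ℝ {x, y, z} := by
    rintro q hq hq'
    refine hd q ⟨?_, hq'⟩ (Or.inl hq)
    rcases hq with rfl | rfl
    · exact left_mem_segment _ _ _
    · exact right_mem_segment _ _ _
  have hVq : ∀ q ∈ ({a, b} : Set R3), q ∈ V := by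
    rintro q (rfl | rfl) <;> assumption
  have hVv : ∀ q ∈ ({x, y, z} : Set R3), q ∈ V := by
    rintro q (rfl | rfl | rfl) <;> assumption
  refine crossing_bdry_triangle (det3_ne_zero hn (hw x hx y hy z hz)) ?_ ?_ (hd2 a (by simp))
    (hd2 b (by simp)) hd1
  · intro v hv p hp t ht h
    by_cases ht0 : t = 0
    · subst ht0
      rw [zero_smul, sub_zero] at h
      subst h
      refine hd1 p hp ?_
      rcases hv with rfl | rfl | rfl
      · exact Or.inl (Or.inl (left_mem_segment _ _ _))
      · exact Or.inl (Or.inr (left_mem_segment _ _ _))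
      · exact Or.inr (left_mem_segment _ _ _)
    · refine hw.sub_smul_notMem (hVv v hv) ha hb (neg_ne_zero.2 ht0) ?_
      rw [← h]
      simpa using hp
  · intro q hq t ht h
    by_cases ht0 : t = 0
    · subst ht0
      rw [zero_smul, sub_zero] at h
      exact hd2 q hq (hsub h)
    · rcases h with (h | h) | h
      · exact hw.sub_smul_notMem (hVq q hq) hx hy ht0 h
      · exact hw.sub_smul_notMem (hVq q hq) hy hz ht0 h
      · exact hw.sub_smul_notMem (hVq q hq) hz hx ht0 h

/-! ### Degenerate triangles -/

theorem exists_smul_of_cross_eq_zero {u v : R3} (h : u ⨯₃ v = 0) :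
    ∃ (d : R3) (η ζ : ℝ), u = η • d ∧ v = ζ • d := by
  by_cases hu : u = 0
  · exact ⟨v, 0, 1, by simp [hu], by simp⟩
  · have h1 : ¬ LinearIndependent ℝ ![u, v] := fun h2 =>
      crossProduct_ne_zero_iff_linearIndependent.2 h2 h
    rw [LinearIndependent.pair_iff' hu] at h1
    push Not at h1
    obtain ⟨c, hc⟩ := h1
    exact ⟨u, 1, c, by simp, hc.symm⟩

theorem mem_segment_line {x d : R3} (hd : d ≠ 0) (ξ η r : ℝ) :
    x + r • d ∈ segment ℝ (x + ξ • d) (x + η • d) ↔ r ∈ Set.uIcc ξ η := by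
  rw [← segment_eq_uIcc]
  constructor
  · rintro ⟨α, β, ha, hb, hs, h⟩
    refine ⟨α, β, ha, hb, hs, ?_⟩
    have h1 : (α * ξ + β * η) • d = r • d := by
      have : α • (x + ξ • d) + β • (x + η • d) = (α + β) • x + (α * ξ + β * η) • d := by module
      rw [this, hs, one_smul] at h
      exact add_left_cancel h
    exact smul_left_injective ℝ hd h1
  · rintro ⟨α, β, ha, hb, hs, rfl⟩
    refine ⟨α, β, ha, hb, hs, ?_⟩
    have : α • (x + ξ • d) + β • (x + η • d) = (α + β) • x + (α * ξ + β * η) • d := by module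
    rw [this, hs, one_smul]
    rfl

theorem crossing_eq_zero_of_det {w a b x y : R3} (h : det3 (b - a) (y - x) w = 0) :
    crossing w a b x y = 0 := by
  unfold crossing
  rw [h, sign_zero]
  simp

/-- The crossings of a segment with three collinear segments that bound a degenerate triangle. -/
theorem crossing_bdry_collinear {V : Set R3} {w a b x y z : R3} (hw : IsGeneric V w)
    (ha : a ∈ V) (hb : b ∈ V) (hx : x ∈ V) (hy : y ∈ V) (hz : z ∈ V)
    (hn : (y - x) ⨯₃ (z - x) = 0) (hd : Disjoint (segment ℝ a b) (convexHull ℝ {x, y, z})) :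
    crossing w a b y z + crossing w a b z x + crossing w a b x y = 0 := by
  classical
  obtain ⟨d, η, ζ, h1, h2⟩ := exists_smul_of_cross_eq_zero hn
  have hy' : y = x + η • d := by rw [← h1]; abel
  have hz' : z = x + ζ • d := by rw [← h2]; abel
  have hx' : x = x + (0 : ℝ) • d := by simp
  have hdet : ∀ ξ ξ' : ℝ, det3 (b - a) (x + ξ' • d - (x + ξ • d)) w =
      (ξ' - ξ) * det3 (b - a) d w := by
    intro ξ ξ'
    simp only [det3_apply, Pi.sub_apply, Pi.add_apply, Pi.smul_apply, smul_eq_mul]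
    ring
  by_cases hδ : det3 (b - a) d w = 0
  · have h0 : ∀ ξ ξ' : ℝ, crossing w a b (x + ξ • d) (x + ξ' • d) = 0 := fun ξ ξ' =>
      crossing_eq_zero_of_det (by rw [hdet, hδ, mul_zero])
    have e1 := h0 η ζ
    have e2 := h0 ζ 0
    have e3 := h0 0 η
    rw [← hy', ← hz'] at e1
    rw [← hx', ← hz'] at e2
    rw [← hx', ← hy'] at e3
    rw [e1, e2, e3]
    rfl
  have hd0 : d ≠ 0 := by
    rintro rfl
    apply hδ
    simp [det3_apply]
  -- Parameters of the points of the common line that lie below `[a, b]`; as `b - a`, `d`, `w` are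
  -- independent, there is at most one.
  set Q : Set ℝ := {r | ∃ p ∈ segment ℝ a b, ∃ t : ℝ, 0 ≤ t ∧ p - t • w = x + r • d} with hQ
  have hsub : Q.Subsingleton := by
    rintro r ⟨p, hp, t, -, h⟩ r' ⟨p', hp', t', -, h'⟩
    rw [segment_eq_image'] at hp hp'
    obtain ⟨s, -, rfl⟩ := hp
    obtain ⟨s', -, rfl⟩ := hp'
    have e : (r - r') • d = (s - s') • (b - a) - (t - t') • w := by
      have : (r - r') • d = (x + r • d) - (x + r' • d) := by module
      rw [this, ← h, ← h']
      module
    have e2 : det3 (b - a) ((r - r') • d) w = 0 := by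
      rw [e]
      simp only [det3_apply, Pi.sub_apply, Pi.smul_apply, smul_eq_mul]
      ring
    have e3 : det3 (b - a) ((r - r') • d) w = (r - r') * det3 (b - a) d w := by
      simp only [det3_apply, Pi.smul_apply, smul_eq_mul]
      ring
    rw [e3] at e2
    exact sub_eq_zero.1 ((mul_eq_zero.1 e2).resolve_right hδ)
  have hcross : ∀ ξ ξ' : ℝ, crossing w a b (x + ξ • d) (x + ξ' • d) =
      if ∃ r ∈ Q, r ∈ Set.uIcc ξ ξ' then
        (SignType.sign ((ξ' - ξ) * det3 (b - a) d w) : ℤ) else 0 := by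
    intro ξ ξ'
    unfold crossing
    rw [hdet]
    congr 1
    refine propext ⟨?_, ?_⟩
    · rintro ⟨p, hp, t, ht, h⟩
      have h3 : ∃ r : ℝ, p - t • w = x + r • d := by
        obtain ⟨α, β, -, -, hs, h⟩ := h
        refine ⟨α * ξ + β * ξ', ?_⟩
        have : α • (x + ξ • d) + β • (x + ξ' • d) = (α + β) • x + (α * ξ + β * ξ') • d := by
          module
        rw [← h, this, hs, one_smul]
      obtain ⟨r, hr⟩ := h3
      rw [hr, mem_segment_line hd0] at h
      exact ⟨r, ⟨p, hp, t, ht, hr⟩, h⟩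
    · rintro ⟨r, ⟨p, hp, t, ht, hr⟩, h⟩
      exact ⟨p, hp, t, ht, by rw [hr, mem_segment_line hd0]; exact h⟩
  have hvert : ∀ ξ : ℝ, x + ξ • d ∈ ({x, y, z} : Set R3) → ξ ∉ Q := by
    rintro ξ hξ ⟨p, hp, t, ht, h⟩
    by_cases ht0 : t = 0
    · rw [ht0, zero_smul, sub_zero] at h
      rw [← h] at hξ
      exact Set.disjoint_left.1 hd hp (subset_convexHull ℝ _ hξ)
    · have hV : x + ξ • d ∈ V := by
        rcases hξ with h | h | h <;> (rw [h]; assumption)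
      refine hw.sub_smul_notMem hV ha hb (neg_ne_zero.2 ht0) ?_
      rw [← h]
      simpa using hp
  have e1 := hcross η ζ
  have e2 := hcross ζ 0
  have e3 := hcross 0 η
  rw [← hy', ← hz'] at e1
  rw [← hx', ← hz'] at e2
  rw [← hx', ← hy'] at e3
  rw [e1, e2, e3]
  rcases hsub.eq_empty_or_singleton with hQ0 | ⟨r, hQr⟩
  · simp [hQ0]
  have hr0 : (0 : ℝ) ≠ r := fun h => hvert 0 (by simp) (by rw [hQr]; exact h)
  have hrη : η ≠ r := fun h => hvert η (by simp [← hy']) (by rw [hQr]; exact h)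
  have hrζ : ζ ≠ r := fun h => hvert ζ (by simp [← hz']) (by rw [hQr]; exact h)
  -- Each crossing is the increment of a step function that jumps at `r`, so the three increments
  -- around the triangle cancel.
  have step : ∀ ξ ξ' : ℝ, ξ ≠ r → ξ' ≠ r → (if ∃ r ∈ Q, r ∈ Set.uIcc ξ ξ' then
      (SignType.sign ((ξ' - ξ) * det3 (b - a) d w) : ℤ) else 0) =
      (if r < ξ' then (SignType.sign (det3 (b - a) d w) : ℤ) else 0) -
        (if r < ξ then (SignType.sign (det3 (b - a) d w) : ℤ) else 0) := by
    intro ξ ξ' h h'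
    rw [sign_mul]
    simp only [hQr, Set.mem_singleton_iff, exists_eq_left, Set.mem_uIcc]
    rcases lt_or_gt_of_ne h with h3 | h3 <;> rcases lt_or_gt_of_ne h' with h4 | h4
    · simp [h3.not_ge, h4.not_ge, h3.not_gt, h4.not_gt]
    · simp [h3.le, h4.le, h4, h3.not_gt, sign_pos (sub_pos.2 (h3.trans h4))]
    · simp only [h3.le, h4.le, h3, h4.not_gt, and_self, or_true, if_true, if_false, zero_sub,
        sign_neg (sub_neg.2 (h4.trans h3))]
      cases SignType.sign (det3 (b - a) d w) <;> rfl
    · simp [h3.not_ge, h4.not_ge, h3, h4]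
  rw [step _ _ hrη hrζ, step _ _ hrζ hr0, step _ _ hr0 hrη]
  ring

/-- The crossings of a segment with the boundary of a triangle disjoint from it. -/
theorem crossing_bdry_of_disjoint {V : Set R3} {w a b x y z : R3} (hw : IsGeneric V w)
    (ha : a ∈ V) (hb : b ∈ V) (hx : x ∈ V) (hy : y ∈ V) (hz : z ∈ V)
    (hd : Disjoint (segment ℝ a b) (convexHull ℝ {x, y, z})) :
    crossing w a b y z + crossing w a b z x + crossing w a b x y =
      -(prismIndex w x y z b - prismIndex w x y z a) := by
  classical
  -- `C2` admits collinear triples; for them both sides are zero.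
  by_cases hn : (y - x) ⨯₃ (z - x) = 0
  · rw [crossing_bdry_collinear hw ha hb hx hy hz hn hd]
    have : det3 (y - x) (z - x) w = 0 := by
      rw [det3, triple_product_permutation, triple_product_permutation, hn, dotProduct_zero]
    simp [prismIndex, this]
  · have := crossing_bdry_triangle_of_generic hw ha hb hx hy hz hn
      (fun p hp => (Set.disjoint_left.1 hd hp.1 hp.2).elim)
    rw [if_neg (by rintro ⟨p, hp, hp'⟩; exact Set.disjoint_left.1 hd hp hp')] at this
    linarith

theorem OTriangle.cross_ne_zero (f : OTriangle) : (f.y - f.x) ⨯₃ (f.z - f.x) ≠ 0 := by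
  rw [crossProduct_ne_zero_iff_linearIndependent]
  have h := f.indep
  rw [affineIndependent_iff_linearIndependent_vsub ℝ _ (0 : Fin 3)] at h
  have h2 := h.comp (fun i : Fin 2 => (⟨i.succ, Fin.succ_ne_zero i⟩ : {x : Fin 3 // x ≠ 0}))
    (fun i j hij => by simpa using hij)
  have h3 : ![f.y - f.x, f.z - f.x] = (fun i : {x : Fin 3 // x ≠ 0} =>
      ![f.x, f.y, f.z] i -ᵥ ![f.x, f.y, f.z] 0) ∘
      (fun i : Fin 2 => (⟨i.succ, Fin.succ_ne_zero i⟩ : {x : Fin 3 // x ≠ 0})) := by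
    funext i
    fin_cases i <;> rfl
  rw [h3]
  exact h2

/-- The local intersection number of a transverse pair in terms of crossings. -/
theorem localIndex_eq_crossing {V : Set R3} {w : R3} (hw : IsGeneric V w) (e : OSegment)
    (f : OTriangle) (ha : e.a ∈ V) (hb : e.b ∈ V) (hx : f.x ∈ V) (hy : f.y ∈ V) (hz : f.z ∈ V)
    (ht : Transverse e f) :
    localIndex e f = crossing w e.a e.b f.y f.z + crossing w e.a e.b f.z f.x +
      crossing w e.a e.b f.x f.y + (prismIndex w f.x f.y f.z e.b - prismIndex w f.x f.y f.z e.a) := by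
  classical
  rw [← crossing_bdry_triangle_of_generic hw ha hb hx hy hz f.cross_ne_zero]
  · unfold localIndex
    by_cases h : e.supp ∩ f.supp = ∅
    · rw [if_pos h, if_neg]
      rintro ⟨p, hp, hp'⟩
      exact (Set.eq_empty_iff_forall_notMem.1 h p) ⟨hp, hp'⟩
    · obtain ⟨p, hp⟩ := Set.nonempty_iff_ne_empty.2 h
      rw [if_neg h, if_pos ⟨p, hp.1, hp.2⟩]
      rfl
  · intro p hp
    rcases ht with h | ⟨q, hq, hq'⟩
    · exact ((Set.eq_empty_iff_forall_notMem.1 h p) hp).elim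
    · have : p ∈ ({q} : Set R3) := hq ▸ hp
      rw [Set.mem_singleton_iff.1 this]
      exact hq'

open MeasureTheory

/-! ### The crossing form on cycles -/

/-- The pairing of a `1`-chain with a function on oriented segments. -/
def pair1 (f : R3 × R3 → ℤ) : C1 →+ ℤ :=
  (Finsupp.linearCombination ℤ f).toAddMonoidHom.comp C1.subtype

theorem pair1_apply (f : R3 × R3 → ℤ) (c : C1) :
    pair1 f c = (c : R3 × R3 →₀ ℤ).sum fun q m => m * f q := rfl

theorem pair1_seg {f : R3 × R3 → ℤ} (hf : ∀ a b, f (b, a) = -f (a, b)) (a b : R3) :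
    pair1 f (seg a b) = 2 * f (a, b) := by
  change Finsupp.linearCombination ℤ f (Finsupp.single (a, b) 1 - Finsupp.single (b, a) 1) = _
  rw [map_sub, Finsupp.linearCombination_single, Finsupp.linearCombination_single, hf a b]
  simp only [smul_eq_mul]
  ring

/-- The crossing number of two `1`-chains in the direction `w`: four times the number of
signed crossings, as every segment is counted with both orientations. -/
def crossForm (w : R3) (c d : C1) : ℤ :=
  pair1 (fun q => pair1 (fun q' => crossing w q.1 q.2 q'.1 q'.2) d) c

theorem crossForm_comm (w : R3) (c d : C1) : crossForm w c d = crossForm (-w) d c := by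
  unfold crossForm
  simp only [pair1_apply, Finsupp.mul_sum]
  rw [Finsupp.sum_comm]
  refine Finsupp.sum_congr fun q _ => Finsupp.sum_congr fun q' _ => ?_
  rw [crossing_comm]
  ring

theorem crossForm_sub_left (w : R3) (c c' d : C1) :
    crossForm w (c - c') d = crossForm w c d - crossForm w c' d := map_sub _ _ _

theorem crossForm_sub_right (w : R3) (c d d' : C1) :
    crossForm w c (d - d') = crossForm w c d - crossForm w c d' := by
  rw [crossForm_comm, crossForm_sub_left, ← crossForm_comm, ← crossForm_comm]

theorem crossForm_sum_left {ι : Type*} (s : Finset ι) (m : ι → ℤ) (a b : ι → R3) (w : R3)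
    (d : C1) : crossForm w (∑ i ∈ s, m i • seg (a i) (b i)) d =
      2 * ∑ i ∈ s, m i * pair1 (fun q => crossing w (a i) (b i) q.1 q.2) d := by
  unfold crossForm
  rw [map_sum, Finset.mul_sum]
  refine Finset.sum_congr rfl fun i _ => ?_
  rw [map_zsmul, pair1_seg]
  · simp only [smul_eq_mul]
    ring
  · intro a b
    rw [pair1_apply, pair1_apply, ← Finsupp.sum_neg]
    refine Finsupp.sum_congr fun q _ => ?_
    rw [crossing_swap_left]
    ring

/-- `bdry2` forgets the first vertex of each stored triple. Coefficients are invariant under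
rotation of the vertices, so the pairing has three equal expressions; their sum displays the whole
boundary of each triangle. -/
theorem pair1_bdry2 (f : R3 × R3 → ℤ) (S : C2) : 3 * pair1 f (bdry2 S) =
    (S : R3 × R3 × R3 →₀ ℤ).sum fun t m =>
      m * (f (t.2.1, t.2.2) + f (t.2.2, t.1) + f (t.1, t.2.1)) := by
  have h0 : pair1 f (bdry2 S) = (S : R3 × R3 × R3 →₀ ℤ).sum fun t m => m * f t.2 := by
    rw [pair1_apply, coe_bdry2, Finsupp.sum_mapDomain_index]
    · intro b; exact zero_mul _
    · intro b m n; exact add_mul _ _ _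
  have hrot : ∀ x y z : R3, (S : R3 × R3 × R3 →₀ ℤ) (y, z, x) =
      (S : R3 × R3 × R3 →₀ ℤ) (x, y, z) := by
    intro x y z
    rw [(S.2 y x z).2, (S.2 x y z).1, neg_neg]
  have key : ∀ F : R3 × R3 × R3 → ℤ, ((S : R3 × R3 × R3 →₀ ℤ).sum fun t m => m * F t) =
      (S : R3 × R3 × R3 →₀ ℤ).sum fun t m => m * F (t.2.1, t.2.2, t.1) := by
    intro F
    unfold Finsupp.sum
    refine Finset.sum_nbij' (fun t => (t.2.2, t.1, t.2.1)) (fun t => (t.2.1, t.2.2, t.1))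
      ?_ ?_ ?_ ?_ ?_
    · rintro ⟨x, y, z⟩ h
      rw [Finsupp.mem_support_iff] at h ⊢
      rwa [hrot] at h
    · rintro ⟨x, y, z⟩ h
      rw [Finsupp.mem_support_iff] at h ⊢
      rwa [hrot]
    · rintro ⟨x, y, z⟩ _
      rfl
    · rintro ⟨x, y, z⟩ _
      rfl
    · rintro ⟨x, y, z⟩ _
      rw [← hrot z x y]
  have h1 : pair1 f (bdry2 S) =
      (S : R3 × R3 × R3 →₀ ℤ).sum fun t m => m * f (t.2.2, t.1) := by
    rw [h0, key]
  have h2 : pair1 f (bdry2 S) =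
      (S : R3 × R3 × R3 →₀ ℤ).sum fun t m => m * f (t.1, t.2.1) := by
    rw [h1, key]
  simp only [mul_add, Finsupp.sum_add]
  rw [← h1, ← h2, ← h0]
  ring

/-- A cycle does not link the boundary of a `2`-chain disjoint from it. -/
theorem ae_crossForm_boundary_right {Y Z : Set R3} (hYZ : Disjoint Y Z) {c d : C1}
    (hc : c ∈ cycles Y) (hd : d ∈ boundaries Z) : ∀ᵐ w : R3, crossForm w c d = 0 := by
  obtain ⟨S, hS, rfl⟩ := hd
  obtain ⟨h, m, e, hsum, hne⟩ := exists_eq_sum_segments c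
  rw [mem_cycles] at hc
  set T := (S : R3 × R3 × R3 →₀ ℤ).support
  set V : Set R3 := (Set.range fun i => (e i).a) ∪ (Set.range fun i => (e i).b) ∪
    ((fun t => t.1) '' (T : Set (R3 × R3 × R3)) ∪ (fun t => t.2.1) '' (T : Set (R3 × R3 × R3)) ∪
      (fun t => t.2.2) '' (T : Set (R3 × R3 × R3))) with hV
  have hVfin : V.Finite := ((Set.finite_range _).union (Set.finite_range _)).union
    (((T.finite_toSet.image _).union (T.finite_toSet.image _)).union (T.finite_toSet.image _))
  filter_upwards [ae_isGeneric hVfin] with w hw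
  have hseg : c = ∑ i, m i • seg (e i).a (e i).b := hsum
  have hb := hc.1
  rw [hseg] at hb
  have h3 : 3 * crossForm w c (bdry2 S) = 0 := by
    rw [hseg, crossForm_sum_left]
    have h4 : ∀ i, 3 * pair1 (fun q => crossing w (e i).a (e i).b q.1 q.2) (bdry2 S) =
        ∑ t ∈ T, -((S : R3 × R3 × R3 →₀ ℤ) t) *
          (prismIndex w t.1 t.2.1 t.2.2 (e i).b - prismIndex w t.1 t.2.1 t.2.2 (e i).a) := by
      intro i
      rw [pair1_bdry2]
      refine Finset.sum_congr rfl fun t ht => ?_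
      have ht' := Finsupp.mem_support_iff.1 ht
      dsimp only
      rw [crossing_bdry_of_disjoint hw]
      · ring
      · exact Or.inl (Or.inl ⟨i, rfl⟩)
      · exact Or.inl (Or.inr ⟨i, rfl⟩)
      · exact Or.inr (Or.inl (Or.inl ⟨t, ht, rfl⟩))
      · exact Or.inr (Or.inl (Or.inr ⟨t, ht, rfl⟩))
      · exact Or.inr (Or.inr ⟨t, ht, rfl⟩)
      · exact hYZ.mono ((segment_subset_supp1 (hne i)).trans hc.2) (hS _ _ _ ht')
    calc 3 * (2 * ∑ i, m i * pair1 (fun q => crossing w (e i).a (e i).b q.1 q.2) (bdry2 S))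
        = 2 * ∑ i, m i * (3 * pair1 (fun q => crossing w (e i).a (e i).b q.1 q.2) (bdry2 S)) := by
          rw [mul_left_comm, Finset.mul_sum]
          congr 1
          exact Finset.sum_congr rfl fun i _ => by ring
      _ = 2 * ∑ t ∈ T, -((S : R3 × R3 × R3 →₀ ℤ) t) * ∑ i, m i •
          (prismIndex w t.1 t.2.1 t.2.2 (e i).b - prismIndex w t.1 t.2.1 t.2.2 (e i).a) := by
          simp only [h4, Finset.mul_sum]
          rw [Finset.sum_comm]
          refine Finset.sum_congr rfl fun t _ => Finset.sum_congr rfl fun i _ => ?_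
          simp only [smul_eq_mul]
          ring
      -- For each triangle the prism indices telescope along the cycle.
      _ = 0 := by
          simp only [fun t : R3 × R3 × R3 => sum_sub_eq_zero Finset.univ m _ _ hb
            (fun p => prismIndex w t.1 t.2.1 t.2.2 p), mul_zero, Finset.sum_const_zero]
  omega

theorem ae_neg {P : R3 → Prop} (h : ∀ᵐ w : R3, P w) : ∀ᵐ w : R3, P (-w) :=
  (Measure.measurePreserving_neg (volume : Measure R3)).quasiMeasurePreserving.ae h

theorem ae_crossForm_boundary_left {Y Z : Set R3} (hYZ : Disjoint Y Z) {c d : C1}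
    (hc : c ∈ boundaries Y) (hd : d ∈ cycles Z) : ∀ᵐ w : R3, crossForm w c d = 0 := by
  filter_upwards [ae_neg (ae_crossForm_boundary_right hYZ.symm hd hc)] with w hw
  rw [crossForm_comm, hw]

theorem ae_crossForm_congr_left {Y Z : Set R3} (hYZ : Disjoint Y Z) {c c' d : C1}
    (hc : HomologousIn Y c c') (hd : d ∈ cycles Z) :
    ∀ᵐ w : R3, crossForm w c d = crossForm w c' d := by
  filter_upwards [ae_crossForm_boundary_left hYZ (homologousIn_iff.1 hc).2.2 hd] with w hw
  rwa [crossForm_sub_left, sub_eq_zero] at hw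

theorem ae_crossForm_congr_right {Y Z : Set R3} (hYZ : Disjoint Y Z) {c d d' : C1}
    (hc : c ∈ cycles Y) (hd : HomologousIn Z d d') :
    ∀ᵐ w : R3, crossForm w c d = crossForm w c d' := by
  filter_upwards [ae_crossForm_boundary_right hYZ hc (homologousIn_iff.1 hd).2.2] with w hw
  rwa [crossForm_sub_right, sub_eq_zero] at hw

/-- A linking number is the crossing number in almost every direction. -/
theorem IsLinkingNumber.ae_eq_crossForm {c d : C1} {n : ℤ} (hd : bdry1 d = 0)
    (hn : IsLinkingNumber c d n) : ∀ᵐ w : R3, crossForm w c d = 4 * n := by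
  obtain ⟨h, k, m, e, l, f, hS, hhom, htr, rfl⟩ := hn
  have hdc : d ∈ cycles (supp1 d) := ⟨hd, subset_rfl⟩
  set V : Set R3 := (Set.range fun i => (e i).a) ∪ (Set.range fun i => (e i).b) ∪
    ((Set.range fun i => (f i).x) ∪ (Set.range fun i => (f i).y) ∪
      (Set.range fun i => (f i).z)) with hV
  have hVfin : V.Finite := ((Set.finite_range _).union (Set.finite_range _)).union
    (((Set.finite_range _).union (Set.finite_range _)).union (Set.finite_range _))
  filter_upwards [ae_crossForm_congr_left disjoint_compl_left hhom hdc, ae_isGeneric hVfin]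
    with w hw1 hw
  rw [hw1]
  have hb : bdry1 (∑ i, m i • seg (e i).a (e i).b) = 0 :=
    (mem_cycles.1 (homologousIn_iff.1 hhom).2.1).1
  change crossForm w (∑ i, m i • seg (e i).a (e i).b) d = _
  rw [crossForm_sum_left, ← hS, map_sum]
  -- Crossings with the sides of a transverse triangle give its local index, up to a prism term that
  -- telescopes in `h2`.
  have h1 : ∀ i j, pair1 (fun q => crossing w (e i).a (e i).b q.1 q.2)
      (bdry2 (l j • (f j).chain)) = 2 * (l j * localIndex (e i) (f j)) - 2 * l j *
        (prismIndex w (f j).x (f j).y (f j).z (e i).b -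
          prismIndex w (f j).x (f j).y (f j).z (e i).a) := by
    intro i j
    have hanti : ∀ a b : R3, (fun q : R3 × R3 => crossing w (e i).a (e i).b q.1 q.2) (b, a) =
        -(fun q : R3 × R3 => crossing w (e i).a (e i).b q.1 q.2) (a, b) :=
      fun a b => crossing_swap_right _ _ _ _ _
    rw [map_zsmul, map_zsmul, OTriangle.chain, bdry2_tri, map_add, map_add, pair1_seg hanti,
      pair1_seg hanti, pair1_seg hanti, localIndex_eq_crossing hw _ _ (Or.inl (Or.inl ⟨i, rfl⟩))
      (Or.inl (Or.inr ⟨i, rfl⟩)) (Or.inr (Or.inl (Or.inl ⟨j, rfl⟩)))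
      (Or.inr (Or.inl (Or.inr ⟨j, rfl⟩))) (Or.inr (Or.inr ⟨j, rfl⟩)) (htr i j)]
    simp only [smul_eq_mul]
    ring
  simp only [map_sum, h1, Finset.sum_sub_distrib, mul_sub]
  have h2 : ∑ i, m i * ∑ j, 2 * l j * (prismIndex w (f j).x (f j).y (f j).z (e i).b -
      prismIndex w (f j).x (f j).y (f j).z (e i).a) = 0 := by
    have h3 : ∀ j, ∑ i, m i * (prismIndex w (f j).x (f j).y (f j).z (e i).b -
        prismIndex w (f j).x (f j).y (f j).z (e i).a) = 0 := fun j => by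
      have := sum_sub_eq_zero Finset.univ m _ _ hb (fun p => prismIndex w (f j).x (f j).y (f j).z p)
      simpa only [smul_eq_mul] using this
    simp only [Finset.mul_sum]
    rw [Finset.sum_comm]
    refine Finset.sum_eq_zero fun j _ => ?_
    have h4 := congrArg (fun t => 2 * l j * t) (h3 j)
    simp only [Finset.mul_sum, mul_zero] at h4
    rw [← h4]
    exact Finset.sum_congr rfl fun i _ => by ring
  simp only [mul_sub, Finset.sum_sub_distrib] at h2
  rw [← mul_sub 2 (Finset.sum _ _) (Finset.sum _ _), h2, mul_zero, sub_zero]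
  simp only [Finset.mul_sum]
  refine Finset.sum_congr rfl fun i _ => Finset.sum_congr rfl fun j _ => by ring

/-- Some direction is good for both choices of data, and the crossing number in it does not depend
on either. -/
theorem IsLinkingNumber.unique {c d : C1} {n n' : ℤ} (hd : bdry1 d = 0)
    (hn : IsLinkingNumber c d n) (hn' : IsLinkingNumber c d n') : n = n' := by
  obtain ⟨w, h1, h2⟩ := ((hn.ae_eq_crossForm hd).and (hn'.ae_eq_crossForm hd)).exists
  omega

/-! ### Deforming cycles -/

theorem seg_mem_chains1_of_convex {K : Set R3} (hK : Convex ℝ K) {a b : R3} (ha : a ∈ K)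
    (hb : b ∈ K) : seg a b ∈ chains1 K := seg_mem_chains1 (hK.segment_subset ha hb)

/-- A quadrilateral with one side replaced by a chain is still a cycle of the convex set. -/
theorem quad_mem_boundaries {K : Set R3} (hK : Convex ℝ K) {a b a' b' : R3} {π : C1}
    (ha : a ∈ K) (hb : b ∈ K) (ha' : a' ∈ K) (hb' : b' ∈ K) (hπ : π ∈ chains1 K)
    (hbd : bdry1 π = Finsupp.single b' 1 - Finsupp.single a' 1) :
    seg a b + seg b b' - π - seg a a' ∈ boundaries K := by
  refine cycles_le_boundaries hK (mem_cycles.2 ⟨?_, ?_⟩)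
  · rw [map_sub, map_sub, map_add, bdry1_seg, bdry1_seg, bdry1_seg, hbd]
    abel
  · exact sub_mem (sub_mem (add_mem (seg_mem_chains1_of_convex hK ha hb)
      (seg_mem_chains1_of_convex hK hb hb')) hπ) (seg_mem_chains1_of_convex hK ha ha')

/-- A cycle is homologous to the cycle obtained by moving its vertices by `g` and replacing its
segments by suitable chains. -/
theorem homologousIn_sum {Y Z : Set R3} (hYZ : Y ⊆ Z) {ι : Type*} (s : Finset ι) (m : ι → ℤ)
    (a b : ι → R3) (hc : ∑ i ∈ s, m i • seg (a i) (b i) ∈ cycles Z) (g : R3 → R3) (π : ι → C1)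
    (hπ : ∀ i, π i ∈ chains1 Y)
    (hbd : ∀ i, bdry1 (π i) = Finsupp.single (g (b i)) 1 - Finsupp.single (g (a i)) 1)
    (hq : ∀ i, seg (a i) (b i) + seg (b i) (g (b i)) - π i - seg (a i) (g (a i)) ∈ boundaries Z) :
    ∑ i ∈ s, m i • π i ∈ cycles Y ∧
      HomologousIn Z (∑ i ∈ s, m i • seg (a i) (b i)) (∑ i ∈ s, m i • π i) := by
  have hb := (mem_cycles.1 hc).1
  have h1 : ∑ i ∈ s, m i • π i ∈ cycles Y := by
    refine mem_cycles.2 ⟨?_, sum_mem fun i _ => zsmul_mem (hπ i) _⟩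
    rw [map_sum, ← sum_sub_eq_zero s m a b hb (fun p => Finsupp.single (g p) (1 : ℤ))]
    exact Finset.sum_congr rfl fun i _ => by rw [map_zsmul, hbd]
  refine ⟨h1, homologousIn_iff.2 ⟨hc, ⟨h1.1, h1.2.trans hYZ⟩, ?_⟩⟩
  have h2 : ∑ i ∈ s, m i • (seg (a i) (b i) + seg (b i) (g (b i)) - π i - seg (a i) (g (a i))) ∈
      boundaries Z := sum_mem fun i _ => zsmul_mem (hq i) _
  -- The tracks `[p, g p]` of the vertices cancel.
  have h3 := sum_sub_eq_zero s m a b hb (fun p => seg p (g p))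
  have h4 : ∑ i ∈ s, m i • (seg (a i) (b i) + seg (b i) (g (b i)) - π i - seg (a i) (g (a i))) =
      ∑ i ∈ s, m i • seg (a i) (b i) - ∑ i ∈ s, m i • π i +
        ∑ i ∈ s, m i • (seg (b i) (g (b i)) - seg (a i) (g (a i))) := by
    rw [← Finset.sum_sub_distrib, ← Finset.sum_add_distrib]
    refine Finset.sum_congr rfl fun i _ => ?_
    rw [← smul_sub, ← smul_add]
    congr 1
    abel
  rwa [h4, h3, add_zero] at h2

/-! ### Existence of linking numbers -/

theorem ae_add_notMem_span (c u u' : R3) : ∀ᵐ v : R3, v + c ∉ Submodule.span ℝ {u, u'} := by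
  have h := Measure.addHaar_submodule (volume : Measure R3) _ (span_pair_ne_top u u')
  exact (measurePreserving_add_right (volume : Measure R3) c).quasiMeasurePreserving.ae
    (measure_eq_zero_iff_ae_notMem.1 h)

theorem ae_affineIndependent {x y : R3} (h : x ≠ y) :
    ∀ᵐ w : R3, AffineIndependent ℝ ![w, x, y] := by
  filter_upwards [ae_add_notMem_span (-x) (y - x) (y - x)] with w hw
  rw [affineIndependent_iff_not_collinear_set]
  intro hcol
  have h1 := hcol.mem_affineSpan_of_mem_of_ne (p₁ := x) (p₂ := y) (p₃ := w) (by simp) (by simp)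
    (by simp) h
  obtain ⟨r, hr⟩ := mem_affineSpan_pair_iff_exists_lineMap_eq.1 h1
  refine hw (Submodule.mem_span_pair.2 ⟨r, 0, ?_⟩)
  rw [← hr, AffineMap.lineMap_apply]
  simp

/-- The translate of a segment. -/
def OSegment.translate (e : OSegment) (v : R3) : OSegment :=
  ⟨e.a + v, e.b + v, fun h => e.ne (add_right_cancel h)⟩

theorem exists_of_mem_segment {a b p : R3} (h : p ∈ segment ℝ a b) :
    ∃ t : ℝ, p = a + t • (b - a) := by
  rw [segment_eq_image'] at h
  obtain ⟨t, -, rfl⟩ := h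
  exact ⟨t, rfl⟩

theorem sub_mem_span_of_mem_convexHull {x y z p : R3} (h : p ∈ convexHull ℝ {x, y, z}) :
    p - x ∈ Submodule.span ℝ {y - x, z - x} := by
  obtain ⟨α, β, γ, -, -, -, hs, rfl⟩ := mem_convexHull_triple.1 h
  refine Submodule.mem_span_pair.2 ⟨β, γ, ?_⟩
  have hα : α = 1 - β - γ := by linarith
  rw [hα]
  module

/-- Bad translations lie in five planes: an end point falls in the plane of `f`, or the segment's
line meets the line of a side. Two common points would force the whole segment into the plane of
`f`, which the first case covers. -/
theorem ae_transverse (e : OSegment) (f : OTriangle) :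
    ∀ᵐ v : R3, Transverse (e.translate v) f := by
  filter_upwards [ae_add_notMem_span (e.a - f.x) (f.y - f.x) (f.z - f.x),
    ae_add_notMem_span (e.b - f.x) (f.y - f.x) (f.z - f.x),
    ae_add_notMem_span (e.a - f.x) (e.b - e.a) (f.y - f.x),
    ae_add_notMem_span (e.a - f.y) (e.b - e.a) (f.z - f.y),
    ae_add_notMem_span (e.a - f.z) (e.b - e.a) (f.x - f.z)] with v ha hb h1 h2 h3
  have hside : ∀ p ∈ (e.translate v).supp, ∀ s t : R3, p ∈ segment ℝ s t →
      v + (e.a - s) ∈ Submodule.span ℝ {e.b - e.a, t - s} := by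
    intro p hp s t hp'
    obtain ⟨τ, hτ⟩ := exists_of_mem_segment hp
    obtain ⟨r, hr⟩ := exists_of_mem_segment hp'
    refine Submodule.mem_span_pair.2 ⟨-τ, r, ?_⟩
    have : e.a + v + τ • (e.b + v - (e.a + v)) = s + r • (t - s) := hτ.symm.trans hr
    rw [add_sub_add_right_eq_sub] at this
    have e2 : r • (t - s) = e.a + v + τ • (e.b - e.a) - s := by rw [this]; abel
    rw [e2]
    module
  rcases Set.eq_empty_or_nonempty ((e.translate v).supp ∩ f.supp) with h | ⟨p, hp, hpf⟩
  · exact Or.inl h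
  refine Or.inr ⟨p, ?_, ?_⟩
  · refine Set.eq_singleton_iff_unique_mem.2 ⟨⟨hp, hpf⟩, ?_⟩
    rintro q ⟨hq, hqf⟩
    by_contra hne
    obtain ⟨τ, hτ⟩ := exists_of_mem_segment hp
    obtain ⟨r, hr⟩ := exists_of_mem_segment hq
    have hp2 := sub_mem_span_of_mem_convexHull hpf
    have hq2 := sub_mem_span_of_mem_convexHull hqf
    simp only [OSegment.translate, add_sub_add_right_eq_sub] at hτ hr
    have hrτ : r - τ ≠ 0 := by
      intro h
      apply hne
      rw [hτ, hr, sub_eq_zero.1 h]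
    have hdir : e.b - e.a ∈ Submodule.span ℝ {f.y - f.x, f.z - f.x} := by
      have h4 : (r - τ) • (e.b - e.a) = (q - f.x) - (p - f.x) := by
        rw [hτ, hr]
        module
      rw [← Submodule.smul_mem_iff _ hrτ, h4]
      exact Submodule.sub_mem _ hq2 hp2
    apply ha
    have h5 : v + (e.a - f.x) = (p - f.x) - τ • (e.b - e.a) := by
      rw [hτ]
      module
    rw [h5]
    exact Submodule.sub_mem _ hp2 (Submodule.smul_mem _ _ hdir)
  · have hpx := sub_mem_span_of_mem_convexHull hpf
    rintro ((h | h) | ((h | h) | h))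
    · apply ha
      rw [h] at hpx
      convert hpx using 1
      simp only [OSegment.translate]
      abel
    · apply hb
      rw [Set.mem_singleton_iff.1 h] at hpx
      convert hpx using 1
      simp only [OSegment.translate]
      abel
    · exact h1 (hside p hp _ _ h)
    · exact h2 (hside p hp _ _ h)
    · exact h3 (hside p hp _ _ h)

/-- Disjoint cycles have a linking number. -/
theorem exists_isLinkingNumber {c d : C1} (hc : bdry1 c = 0) (hd : bdry1 d = 0)
    (hcd : Disjoint (supp1 c) (supp1 d)) : ∃ n, IsLinkingNumber c d n := by
  obtain ⟨h, m, e, hsum, hne⟩ := exists_eq_sum_segments c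
  obtain ⟨k, l, f, hsum', -⟩ := exists_eq_sum_segments d
  have hcseg : c = ∑ i, m i • seg (e i).a (e i).b := hsum
  have hdseg : d = ∑ i, l i • seg (f i).a (f i).b := hsum'
  -- A generic apex makes every triangle of the cone over `d` nondegenerate.
  obtain ⟨w, hw⟩ := (ae_all_iff.2 fun j => ae_affineIndependent (f j).ne).exists
  set F : Fin k → OTriangle := fun j => ⟨w, (f j).a, (f j).b, hw j⟩ with hF
  obtain ⟨δ, hδ, hsub⟩ := (isCompact_supp1 c).exists_cthickening_subset_open
    (isCompact_supp1 d).isClosed.isOpen_compl (Set.disjoint_left.1 hcd)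
  -- Good translations are dense, so one is shorter than `δ`; each moving edge then stays in its own
  -- thickening, which is convex and misses `|d|`.
  obtain ⟨v, hv, hvδ⟩ := (Measure.dense_of_ae (ae_all_iff.2 fun i => ae_all_iff.2 fun j =>
    ae_transverse (e i) (F j))).exists_dist_lt 0 hδ
  rw [dist_zero_left] at hvδ
  refine ⟨_, h, k, m, fun i => (e i).translate v, l, F, ?_, ?_, hv, rfl⟩
  · rw [hdseg] at hd
    conv_rhs => rw [hdseg, ← bdry2_cone _ _ _ _ hd w]
    rfl
  · have hK : ∀ i, Convex ℝ (Metric.cthickening δ (segment ℝ (e i).a (e i).b)) :=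
      fun i => (convex_segment _ _).cthickening δ
    have hKZ : ∀ i, Metric.cthickening δ (segment ℝ (e i).a (e i).b) ⊆ (supp1 d)ᶜ := fun i =>
      (Metric.cthickening_subset_of_subset _ (segment_subset_supp1 (hne i))).trans hsub
    have hmem : ∀ i, ∀ p ∈ segment ℝ (e i).a (e i).b,
        p ∈ Metric.cthickening δ (segment ℝ (e i).a (e i).b) ∧
        p + v ∈ Metric.cthickening δ (segment ℝ (e i).a (e i).b) := fun i p hp =>
      ⟨Metric.self_subset_cthickening _ hp,
        Metric.mem_cthickening_of_dist_le _ p _ _ hp (by simpa using hvδ.le)⟩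
    have ha := fun i => hmem i _ (left_mem_segment ℝ (e i).a (e i).b)
    have hb := fun i => hmem i _ (right_mem_segment ℝ (e i).a (e i).b)
    have hπ := fun i => seg_mem_chains1_of_convex (hK i) (ha i).2 (hb i).2
    have hcyc : ∑ i, m i • seg (e i).a (e i).b ∈ cycles (supp1 d)ᶜ := by
      rw [← hcseg]
      exact mem_cycles.2 ⟨hc, Set.disjoint_left.1 hcd⟩
    have := (homologousIn_sum subset_rfl Finset.univ m _ _ hcyc (fun p => p + v)
      (fun i => seg ((e i).a + v) ((e i).b + v)) (fun i => chains1_mono (hKZ i) (hπ i))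
      (fun i => bdry1_seg _ _) (fun i => boundaries_mono (hKZ i)
        (quad_mem_boundaries (hK i) (ha i).1 (hb i).1 (ha i).2 (hb i).2 (hπ i)
          (bdry1_seg _ _)))).2
    rw [← hcseg] at this
    exact this

open Filter Topology

/-! ### Pushing a cycle off the boundary of a domain -/

/-- Being joined by a chain is symmetric and transitive, and holds inside small balls. -/
theorem exists_chain_of_isPreconnected {W : Set R3} (hW : IsOpen W) (hc : IsPreconnected W)
    {x y : R3} (hx : x ∈ W) (hy : y ∈ W) :
    ∃ π ∈ chains1 W, bdry1 π = Finsupp.single y 1 - Finsupp.single x 1 := by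
  refine hc.induction₂ (fun x y => ∃ π ∈ chains1 W,
    bdry1 π = Finsupp.single y 1 - Finsupp.single x 1) ?_ ?_ ?_ hx hy
  · intro u hu
    obtain ⟨ε, hε, hball⟩ := Metric.isOpen_iff.1 hW u hu
    filter_upwards [mem_nhdsWithin_of_mem_nhds (Metric.ball_mem_nhds u hε)] with v hv
    exact ⟨seg u v, chains1_mono hball (seg_mem_chains1_of_convex (convex_ball u ε)
      (Metric.mem_ball_self hε) hv), bdry1_seg u v⟩
  · rintro u v t - - - ⟨π, hπ, h⟩ ⟨π', hπ', h'⟩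
    exact ⟨π + π', add_mem hπ hπ', by rw [map_add, h, h']; abel⟩
  · rintro u v - - ⟨π, hπ, h⟩
    exact ⟨-π, neg_mem hπ, by rw [map_neg, h]; abel⟩

/-- The points of `Ω` near `x` are connected to each other in `Ω` near `x`. -/
def IsLocallyConnectedNear (Ω : Set R3) (x : R3) : Prop :=
  ∀ ε > 0, ∃ δ > 0, ∃ W : Set R3, IsOpen W ∧ IsPreconnected W ∧ W ⊆ Metric.ball x ε ∩ Ω ∧
    Metric.ball x δ ∩ Ω ⊆ W

/-- The segment `[x, y]` can be pushed in `Z` to a chain of `Ω` from `x'` to `y'`. -/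
def CanPush (Ω Z : Set R3) (x y x' y' : R3) : Prop :=
  ∃ π ∈ chains1 (Ω ∩ Z), bdry1 π = Finsupp.single y' 1 - Finsupp.single x' 1 ∧
    seg x y + seg y y' - π - seg x x' ∈ boundaries Z

theorem CanPush.symm {Ω Z : Set R3} {x y x' y' : R3} (h : CanPush Ω Z x y x' y') :
    CanPush Ω Z y x y' x' := by
  obtain ⟨π, hπ, hb, hq⟩ := h
  refine ⟨-π, neg_mem hπ, by rw [map_neg, hb]; abel, ?_⟩
  have := neg_mem hq
  rw [seg_swap x y]
  convert this using 1
  abel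

/-- The two pushes concatenate up to the triangle `[x, y, z]`, whose boundary bounds in `K`. -/
theorem CanPush.trans {Ω Z K : Set R3} (hK : Convex ℝ K) (hKZ : K ⊆ Z) {x y z x' y' z' : R3}
    (hx : x ∈ K) (hy : y ∈ K) (hz : z ∈ K) (h : CanPush Ω Z x y x' y')
    (h' : CanPush Ω Z y z y' z') : CanPush Ω Z x z x' z' := by
  obtain ⟨π, hπ, hb, hq⟩ := h
  obtain ⟨π', hπ', hb', hq'⟩ := h'
  refine ⟨π + π', add_mem hπ hπ', by rw [map_add, hb, hb']; abel, ?_⟩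
  have htri : seg x y + seg y z - seg x z ∈ boundaries Z := by
    refine boundaries_mono hKZ (cycles_le_boundaries hK (mem_cycles.2 ⟨?_, ?_⟩))
    · rw [map_sub, map_add, bdry1_seg, bdry1_seg, bdry1_seg]
      abel
    · exact sub_mem (add_mem (seg_mem_chains1_of_convex hK hx hy)
        (seg_mem_chains1_of_convex hK hy hz)) (seg_mem_chains1_of_convex hK hx hz)
  have := sub_mem (add_mem hq hq') htri
  convert this using 1
  abel

/-- Connectedness of the segment replaces a subdivision: the property holds for nearby points by the
local connectedness of `Ω`, and propagates by transitivity. It is stated for all targets near the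
end points so that adjacent segments can share them. -/
theorem eventually_canPush {Ω Z : Set R3} (hZ : IsOpen Z) {a b : R3} (hab : segment ℝ a b ⊆ Z)
    (hcl : segment ℝ a b ⊆ closure Ω)
    (hloc : ∀ x ∈ segment ℝ a b, IsLocallyConnectedNear Ω x) :
    ∀ᶠ q in 𝓝[Ω] a ×ˢ 𝓝[Ω] b, CanPush Ω Z a b q.1 q.2 := by
  have hconv := convex_segment (𝕜 := ℝ) a b
  refine hconv.isPreconnected.induction₂
    (fun x y => ∀ᶠ q in 𝓝[Ω] x ×ˢ 𝓝[Ω] y, CanPush Ω Z x y q.1 q.2) ?_ ?_ ?_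
    (left_mem_segment _ _ _) (right_mem_segment _ _ _)
  · intro x hx
    obtain ⟨ε, hε, hball⟩ := Metric.isOpen_iff.1 hZ x (hab hx)
    obtain ⟨δ, hδ, W, hW, hWc, hWsub, hWsup⟩ := hloc x hx ε hε
    have hx1 : Metric.ball x δ ∩ Metric.ball x ε ∈ 𝓝 x :=
      inter_mem (Metric.ball_mem_nhds x hδ) (Metric.ball_mem_nhds x hε)
    filter_upwards [mem_nhdsWithin_of_mem_nhds hx1] with y hy
    have hy1 : Metric.ball x δ ∩ Metric.ball x ε ∈ 𝓝 y :=
      (Metric.isOpen_ball.inter Metric.isOpen_ball).mem_nhds hy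
    have e1 : ∀ᶠ p in 𝓝[Ω] x, p ∈ W := by
      filter_upwards [mem_nhdsWithin_of_mem_nhds hx1, self_mem_nhdsWithin] with p hp hp'
      exact hWsup ⟨hp.1, hp'⟩
    have e2 : ∀ᶠ p in 𝓝[Ω] y, p ∈ W := by
      filter_upwards [mem_nhdsWithin_of_mem_nhds hy1, self_mem_nhdsWithin] with p hp hp'
      exact hWsup ⟨hp.1, hp'⟩
    filter_upwards [e1.prod_mk e2] with q hq
    obtain ⟨π, hπ, hb⟩ := exists_chain_of_isPreconnected hW hWc hq.1 hq.2
    have hWZ : W ⊆ Ω ∩ Z := fun p hp => ⟨(hWsub hp).2, hball (hWsub hp).1⟩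
    exact ⟨π, chains1_mono hWZ hπ, hb,
      boundaries_mono hball (quad_mem_boundaries (convex_ball x ε) (Metric.mem_ball_self hε) hy.2
        (hWsub hq.1).1 (hWsub hq.2).1 (chains1_mono (fun p hp => (hWsub hp).1) hπ) hb)⟩
  · intro x y z hx hy hz h h'
    obtain ⟨A, hA, B, hB, hAB⟩ := eventually_prod_iff.1 h
    obtain ⟨B', hB', C, hC, hBC⟩ := eventually_prod_iff.1 h'
    have : (𝓝[Ω] y).NeBot := mem_closure_iff_nhdsWithin_neBot.1 (hcl hy)
    -- A common intermediate target in `Ω`, suitable for both pushes.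
    obtain ⟨y', hy1, hy2⟩ := (hB.and hB').exists
    filter_upwards [hA.prod_mk hC] with q hq
    have r₁ : CanPush Ω Z x y q.1 y' := hAB hq.1 hy1
    have r₂ : CanPush Ω Z y z y' q.2 := hBC hy2 hq.2
    exact CanPush.trans hconv hab hx hy hz r₁ r₂
  · intro x y _ _ h
    filter_upwards [(eventually_swap_iff.1 h)] with q hq
    exact CanPush.symm hq

/-- A cycle in the boundary of a domain with one local side can be pushed into the domain. -/
theorem exists_push {Ω Z : Set R3} (hZ : IsOpen Z) {d : C1} (hd : d ∈ cycles Z)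
    (hcl : supp1 d ⊆ closure Ω) (hloc : ∀ x ∈ supp1 d, IsLocallyConnectedNear Ω x) :
    ∃ d' ∈ cycles Ω, HomologousIn Z d d' := by
  obtain ⟨h, m, e, hsum, hne⟩ := exists_eq_sum_segments d
  have hseg : d = ∑ i, m i • seg (e i).a (e i).b := hsum
  have hsub := fun i => segment_subset_supp1 (hne i)
  have hev := fun i => eventually_prod_iff.1 (eventually_canPush hZ ((hsub i).trans hd.2)
    ((hsub i).trans hcl) (fun x hx => hloc x (hsub i hx)))
  choose A hA B hB hAB using hev
  -- One target per vertex, good for all incident segments at once, so that the pushed chain closes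
  -- up.
  have hg : ∀ v : R3, ∃ v', v ∈ closure Ω →
      (∀ i, (e i).a = v → A i v') ∧ ∀ i, (e i).b = v → B i v' := by
    intro v
    by_cases hv : v ∈ closure Ω
    · have : (𝓝[Ω] v).NeBot := mem_closure_iff_nhdsWithin_neBot.1 hv
      have h1 : ∀ᶠ v' in 𝓝[Ω] v, ∀ i, (e i).a = v → A i v' :=
        eventually_all.2 fun i => eventually_imp_distrib_left.2 fun hi => hi ▸ hA i
      have h2 : ∀ᶠ v' in 𝓝[Ω] v, ∀ i, (e i).b = v → B i v' :=
        eventually_all.2 fun i => eventually_imp_distrib_left.2 fun hi => hi ▸ hB i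
      obtain ⟨v', hv'⟩ := (h1.and h2).exists
      exact ⟨v', fun _ => hv'⟩
    · exact ⟨0, fun h => absurd h hv⟩
  choose g hg using hg
  have hpush : ∀ i, CanPush Ω Z (e i).a (e i).b (g (e i).a) (g (e i).b) := fun i =>
    hAB i ((hg _ (hcl (hsub i (left_mem_segment _ _ _)))).1 i rfl)
      ((hg _ (hcl (hsub i (right_mem_segment _ _ _)))).2 i rfl)
  choose π hπ hb hq using hpush
  rw [hseg] at hd
  obtain ⟨h1, h2⟩ := homologousIn_sum (Set.inter_subset_right (s := Ω)) Finset.univ m _ _ hd g π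
    hπ hb hq
  rw [← hseg] at h2
  exact ⟨_, ⟨h1.1, h1.2.trans Set.inter_subset_left⟩, h2⟩

/-! ### The two sides of a locally flat surface -/

/-- The sides are the images of the two open halves of a small ball in the chart. The halves are
convex, and each accumulates at every point of the ball's equatorial disc. -/
theorem LocallyFlat.exists_sides {F : Set R3} (hF : LocallyFlat F) {x : R3} (hx : x ∈ F) {ε : ℝ}
    (hε : 0 < ε) : ∃ N N₁ N₂ : Set R3, N ∈ 𝓝 x ∧ N ⊆ Metric.ball x ε ∧
      (IsOpen N₁ ∧ IsPreconnected N₁ ∧ N ∩ F ⊆ closure N₁) ∧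
      (IsOpen N₂ ∧ IsPreconnected N₂ ∧ N ∩ F ⊆ closure N₂) ∧ N \ F = N₁ ∪ N₂ := by
  obtain ⟨U, hU, hxU, φ, hφ⟩ := hF x hx
  set ψ : R3 → R3 := fun z => (φ.symm z : R3) with hψ
  have hψe : IsOpenEmbedding ψ := hU.isOpenEmbedding_subtypeVal.comp φ.symm.isOpenEmbedding
  have hψF : ∀ z, ψ z ∈ F ↔ z 2 = 0 := fun z => by rw [hφ, φ.apply_symm_apply]
  set z₀ := φ ⟨x, hxU⟩ with hz₀
  have hψz : ψ z₀ = x := by simp [hψ, hz₀]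
  obtain ⟨ρ, hρ, hball⟩ := Metric.mem_nhds_iff.1
    (hψe.continuous.continuousAt.preimage_mem_nhds (Metric.ball_mem_nhds (ψ z₀) hε))
  rw [hψz] at hball
  set B := Metric.ball z₀ ρ
  have hclos : ∀ s : ℝ, s ≠ 0 → ∀ z ∈ B, z 2 = 0 → ψ z ∈ closure (ψ '' (B ∩ {z | 0 < s * z 2})) := by
    intro s hs z hz hz2
    set f : ℝ → R3 := fun t => z + t • Pi.single 2 s with hf
    have hfc : Continuous f := by fun_prop
    have hf0 : f 0 = z := by simp [hf]
    have ht : Tendsto (fun t => ψ (f t)) (𝓝[>] 0) (𝓝 (ψ z)) := by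
      have := (hψe.continuous.comp hfc).tendsto 0
      simp only [Function.comp_apply, hf0] at this
      exact this.mono_left nhdsWithin_le_nhds
    refine mem_closure_of_tendsto ht ?_
    have hB : ∀ᶠ t in 𝓝[>] (0 : ℝ), f t ∈ B := by
      have : f ⁻¹' B ∈ 𝓝 (0 : ℝ) := hfc.continuousAt.preimage_mem_nhds
        (by rw [hf0]; exact Metric.isOpen_ball.mem_nhds hz)
      exact mem_nhdsWithin_of_mem_nhds this
    filter_upwards [hB, self_mem_nhdsWithin] with t ht1 ht2
    have ht2' : 0 < t := ht2
    refine ⟨f t, ⟨ht1, ?_⟩, rfl⟩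
    simp only [hf, Set.mem_ofPred_eq, Pi.add_apply, Pi.smul_apply, Pi.single_eq_same, hz2,
      smul_eq_mul, zero_add]
    have := mul_self_pos.2 hs
    nlinarith
  have hside : ∀ s : ℝ, s ≠ 0 → IsOpen (ψ '' (B ∩ {z | 0 < s * z 2})) ∧
      IsPreconnected (ψ '' (B ∩ {z | 0 < s * z 2})) ∧
      ψ '' B ∩ F ⊆ closure (ψ '' (B ∩ {z | 0 < s * z 2})) := by
    intro s hs
    refine ⟨?_, ?_, ?_⟩
    · exact hψe.isOpenMap _ (Metric.isOpen_ball.inter (isOpen_lt continuous_const (by fun_prop)))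
    · refine (Convex.isPreconnected ((convex_ball _ _).inter ?_)).image _
        hψe.continuous.continuousOn
      exact convex_halfSpace_gt
        ⟨fun u v => by simp [mul_add], fun c u => by simp [mul_left_comm]⟩ 0
    · rintro _ ⟨⟨z, hz, rfl⟩, hzF⟩
      exact hclos s hs z hz ((hψF z).1 hzF)
  refine ⟨ψ '' B, _, _, ?_, ?_, hside 1 one_ne_zero, hside (-1) (by norm_num), ?_⟩
  · have := hψe.isOpenMap.image_mem_nhds (Metric.ball_mem_nhds z₀ hρ)
    rwa [hψz] at this
  · rintro _ ⟨z, hz, rfl⟩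
    exact hball hz
  · ext y
    constructor
    · rintro ⟨⟨z, hz, rfl⟩, hzF⟩
      rw [hψF] at hzF
      rcases lt_or_gt_of_ne hzF with h | h
      · exact Or.inr ⟨z, ⟨hz, by simpa using h⟩, rfl⟩
      · exact Or.inl ⟨z, ⟨hz, by simpa using h⟩, rfl⟩
    · rintro (⟨z, ⟨hz, h⟩, rfl⟩ | ⟨z, ⟨hz, h⟩, rfl⟩)
      · refine ⟨⟨z, hz, rfl⟩, ?_⟩
        rw [hψF]
        simp only [Set.mem_ofPred_eq] at h
        intro h0
        simp [h0] at h
      · refine ⟨⟨z, hz, rfl⟩, ?_⟩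
        rw [hψF]
        simp only [Set.mem_ofPred_eq] at h
        intro h0
        simp [h0] at h

theorem subset_of_disjoint_frontier {s E : Set R3} (hs : IsPreconnected s)
    (hE : IsOpen E) (hd : Disjoint s (frontier E)) (hne : (s ∩ E).Nonempty) : s ⊆ E := by
  refine hs.subset_left_of_subset_union hE isClosed_closure.isOpen_compl
    (disjoint_compl_right.mono_left subset_closure) ?_ hne
  intro x hx
  by_cases h : x ∈ E
  · exact Or.inl h
  · refine Or.inr fun h' => Set.disjoint_left.1 hd hx ?_
    rw [hE.frontier_eq]
    exact ⟨h', h⟩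

/-- A side is connected and misses the frontier of `E`, so it lies in `E` as soon as it meets `E`.
Near `x` the open set `E` does meet a side, since points of `F` are limits of `N₁`. -/
theorem side_subset {F E N N₁ N₂ : Set R3} {x : R3} (hE : IsOpen E) (hEF : frontier E ⊆ F)
    (hN : N ∈ 𝓝 x) (h₁ : IsOpen N₁ ∧ IsPreconnected N₁ ∧ N ∩ F ⊆ closure N₁)
    (h₂ : IsOpen N₂ ∧ IsPreconnected N₂ ∧ N ∩ F ⊆ closure N₂) (hU : N \ F = N₁ ∪ N₂)
    (hx : x ∈ closure E) : N₁ ⊆ E ∨ N₂ ⊆ E := by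
  have hd₁ : Disjoint N₁ (frontier E) := Set.disjoint_left.2 fun y hy hy' =>
    (hU.symm ▸ Or.inl hy : y ∈ N \ F).2 (hEF hy')
  have hd₂ : Disjoint N₂ (frontier E) := Set.disjoint_left.2 fun y hy hy' =>
    (hU.symm ▸ Or.inr hy : y ∈ N \ F).2 (hEF hy')
  obtain ⟨y, hyN, hyE⟩ := mem_closure_iff_nhds.1 hx N hN
  by_cases hyF : y ∈ F
  · obtain ⟨u, huE, huN⟩ := mem_closure_iff.1 (h₁.2.2 ⟨hyN, hyF⟩) E hE hyE
    exact Or.inl (subset_of_disjoint_frontier h₁.2.1 hE hd₁ ⟨u, huN, huE⟩)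
  · have hy : y ∈ N₁ ∪ N₂ := hU ▸ ⟨hyN, hyF⟩
    rcases hy with hy | hy
    · exact Or.inl (subset_of_disjoint_frontier h₁.2.1 hE hd₁ ⟨y, hy, hyE⟩)
    · exact Or.inr (subset_of_disjoint_frontier h₂.2.1 hE hd₂ ⟨y, hy, hyE⟩)

/-- A connected piece of a locally flat surface that contains the frontier of an open set lies in
the closure of that set. -/
theorem LocallyFlat.subset_closure {F Γ E : Set R3} (hF : LocallyFlat F) (hΓ : IsPreconnected Γ)
    (hΓF : Γ ⊆ F) (hE : IsOpen E) (hEΓ : frontier E ⊆ Γ) (hne : E.Nonempty)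
    (huniv : E ≠ Set.univ) : Γ ⊆ closure E := by
  obtain ⟨y, hy⟩ := nonempty_frontier_iff.2 ⟨hne, huniv⟩
  intro x hx
  -- Membership in `closure E` is locally constant along `Γ`, and holds at a frontier point of `E`.
  refine (hΓ.induction₂ (fun x y => x ∈ closure E ↔ y ∈ closure E) ?_
    (fun _ _ _ _ _ _ h h' => h.trans h') (fun _ _ _ _ h => h.symm) (hEΓ hy) hx).1
    (frontier_subset_closure hy)
  intro u hu
  by_cases huE : u ∈ closure E
  · obtain ⟨N, N₁, N₂, hN, -, h₁, h₂, hU⟩ := hF.exists_sides (hΓF hu) one_pos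
    have hNE : N ∩ F ⊆ closure E := by
      rcases side_subset hE (hEΓ.trans hΓF) hN h₁ h₂ hU huE with h | h
      · exact h₁.2.2.trans (closure_mono h)
      · exact h₂.2.2.trans (closure_mono h)
    filter_upwards [mem_nhdsWithin_of_mem_nhds hN, self_mem_nhdsWithin] with v hv hv'
    exact iff_of_true huE (hNE ⟨hv, hΓF hv'⟩)
  · filter_upwards [mem_nhdsWithin_of_mem_nhds (isClosed_closure.isOpen_compl.mem_nhds huE)]
      with v hv
    exact iff_of_false huE hv

/-- If both `Ω` and a disjoint open set are adherent to a point of the locally flat frontier of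
`Ω`, then `Ω` lies locally on one side. -/
theorem LocallyFlat.isLocallyConnectedNear {Ω E : Set R3} (hF : LocallyFlat (frontier Ω))
    (hΩ : IsOpen Ω) (hE : IsOpen E) (hEF : frontier E ⊆ frontier Ω) (hd : Disjoint E Ω) {x : R3}
    (hx : x ∈ frontier Ω) (hxE : x ∈ closure E) : IsLocallyConnectedNear Ω x := by
  intro ε hε
  obtain ⟨N, N₁, N₂, hN, hNε, h₁, h₂, hU⟩ := hF.exists_sides hx hε
  obtain ⟨δ, hδ, hball⟩ := Metric.mem_nhds_iff.1 hN
  have hxN : x ∈ N := mem_of_mem_nhds hN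
  have key : ∀ M₁ M₂ : Set R3, IsOpen M₂ ∧ IsPreconnected M₂ ∧ N ∩ frontier Ω ⊆ closure M₂ →
      N \ frontier Ω = M₁ ∪ M₂ → M₁ ⊆ E → M₂ ⊆ Ω → ∃ δ > 0, ∃ W : Set R3, IsOpen W ∧
      IsPreconnected W ∧ W ⊆ Metric.ball x ε ∩ Ω ∧ Metric.ball x δ ∩ Ω ⊆ W := by
    intro M₁ M₂ h hM hM₁ hM₂
    refine ⟨δ, hδ, M₂, h.1, h.2.1, fun y hy => ⟨hNε ?_, hM₂ hy⟩, ?_⟩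
    · exact (hM.symm ▸ Or.inr hy : y ∈ N \ frontier Ω).1
    · rintro y ⟨hy, hyΩ⟩
      have hyF : y ∉ frontier Ω := fun h' => by
        rw [hΩ.frontier_eq] at h'
        exact h'.2 hyΩ
      have : y ∈ M₁ ∪ M₂ := hM ▸ ⟨hball hy, hyF⟩
      exact this.resolve_left fun h' => Set.disjoint_left.1 hd (hM₁ h') hyΩ
  -- A side is nonempty, as it accumulates at `x`; hence `E` and `Ω` cannot share it.
  have hnot : ∀ M : Set R3, N ∩ frontier Ω ⊆ closure M → M ⊆ E → M ⊆ Ω → False := by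
    intro M hM hME hMΩ
    obtain ⟨y, hy⟩ := closure_nonempty_iff.1 ⟨x, hM ⟨hxN, hx⟩⟩
    exact Set.disjoint_left.1 hd (hME hy) (hMΩ hy)
  rcases side_subset hE hEF hN h₁ h₂ hU hxE with h | h <;>
    rcases side_subset hΩ subset_rfl hN h₁ h₂ hU (frontier_subset_closure hx) with h' | h'
  · exact (hnot _ h₁.2.2 h h').elim
  · exact key _ _ h₂ hU h h'
  · exact key _ _ h₁ (hU.trans (Set.union_comm _ _)) h h'
  · exact (hnot _ h₂.2.2 h h').elim

/-! ### Vanishing of linking numbers -/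

/-- The linking number of a cycle outside `Ω` with a cycle on the frontier of `Ω` is computed by
any homologous cycle, and vanishes if the latter cycle bounds away from it. -/
theorem IsLinkingNumber.eq_zero {Ω Γ Γ' B : Set R3} {c c' d : C1} {n : ℤ}
    (hΓ : IsClosed Γ) (hΓΓ' : Disjoint Γ Γ') (hΓB : Disjoint Γ B) (hΓ' : Γ' ⊆ closure Ω)
    (hloc : ∀ x ∈ Γ', IsLocallyConnectedNear Ω x) (hc : Disjoint (supp1 c) Γ')
    (hcc' : HomologousIn Ωᶜ c c') (hc' : c' ∈ cycles Γ) (hd : d ∈ cycles Γ') (hdB : d ∈ boundaries B)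
    (hn : IsLinkingNumber c d n) : n = 0 := by
  -- The push of `d` must change the linking neither with `c` nor with `c'`.
  set Z := (Γ ∪ supp1 c)ᶜ with hZ
  have hZo : IsOpen Z := (hΓ.union (isCompact_supp1 c).isClosed).isOpen_compl
  have hΓZ : Γ' ⊆ Z := fun x hx hx' => hx'.elim (fun h => Set.disjoint_left.1 hΓΓ' h hx)
    fun h => Set.disjoint_left.1 hc h hx
  obtain ⟨d', hd', hdd'⟩ := exists_push hZo (mem_cycles.2 ⟨hd.1, chains1_mono hΓZ hd.2⟩)
    (hd.2.trans hΓ') (fun x hx => hloc x (hd.2 hx))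
  have hcs : c ∈ cycles (supp1 c) := ⟨(homologousIn_iff.1 hcc').1.1, subset_rfl⟩
  -- In a common good direction: replace `d` by `d'`, then `c` by `c'` (now legitimate, as `d'` lies
  -- in `Ω`), then `d'` by `d`, which bounds away from `c'`.
  obtain ⟨w, h1, h2, h3, h4, h5⟩ := ((hn.ae_eq_crossForm hd.1).and
    ((ae_crossForm_congr_right (disjoint_compl_right.mono_left Set.subset_union_right) hcs hdd').and
    ((ae_crossForm_congr_left disjoint_compl_left hcc' hd').and
    ((ae_crossForm_congr_right (disjoint_compl_right.mono_left Set.subset_union_left) hc' hdd').and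
    (ae_crossForm_boundary_right hΓB hc' hdB))))).exists
  omega

/-! ### Bounded components of the complement of a closed set -/

theorem isClosed_connectedComponentIn {X : Type*} [TopologicalSpace X] {F : Set X}
    (hF : IsClosed F) (x : X) : IsClosed (connectedComponentIn F x) := by
  by_cases hx : x ∈ F
  · refine isClosed_of_closure_subset ?_
    exact isPreconnected_connectedComponentIn.closure.subset_connectedComponentIn
      (subset_closure (mem_connectedComponentIn hx))
      (closure_minimal (connectedComponentIn_subset F x) hF)
  · rw [connectedComponentIn_eq_empty hx]
    exact isClosed_empty

theorem IsBoundedComponent.isOpen {K D : Set R3} (hK : IsClosed K) (h : IsBoundedComponent K D) :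
    IsOpen D := by
  obtain ⟨-, x, -, rfl⟩ := h
  exact hK.isOpen_compl.connectedComponentIn

theorem IsBoundedComponent.nonempty {K D : Set R3} (h : IsBoundedComponent K D) :
    D.Nonempty := by
  obtain ⟨-, x, hx, rfl⟩ := h
  exact ⟨x, mem_connectedComponentIn hx⟩

/-- A frontier point off `K` has an open component that meets `D`, hence equals `D`; but the open
set `D` contains no frontier point. -/
theorem IsBoundedComponent.frontier_subset {K D : Set R3} (hK : IsClosed K)
    (h : IsBoundedComponent K D) : frontier D ⊆ K := by
  have hD := h.isOpen hK
  obtain ⟨-, x, hx, rfl⟩ := h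
  intro y hy
  by_contra hyK
  rw [hD.frontier_eq] at hy
  obtain ⟨z, hz, hz'⟩ := mem_closure_iff.1 hy.1 _ (hK.isOpen_compl.connectedComponentIn (x := y))
    (mem_connectedComponentIn hyK)
  apply hy.2
  rw [connectedComponentIn_eq hz', ← connectedComponentIn_eq hz]
  exact mem_connectedComponentIn hyK

theorem ne_univ_of_isBounded {s : Set R3} (h : Bornology.IsBounded s) : s ≠ Set.univ := by
  rintro rfl
  exact NormedSpace.unbounded_univ ℝ R3 h

end PL

end

/-! ### Linking matrices of the boundary components -/

theorem mainTheorem2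
    -- a bounded domain with polyhedral closure and locally flat boundary
    (Ω : Set PL.R3) (hopen : IsOpen Ω) (hconn : IsConnected Ω) (hbdd : Bornology.IsBounded Ω)
    (hflat : PL.LocallyFlat (frontier Ω))
    (T : Geometry.SimplicialComplex ℝ PL.R3) (hTfin : T.faces.Finite) (hT : T.space = closure Ω)
    -- the connected components of the boundary, and the regions that they bound
    (p : ℕ) (Γ : Fin (p + 1) → Set PL.R3) (hΓinj : Function.Injective Γ)
    (hΓ : Set.range Γ = connectedComponentIn (frontier Ω) '' frontier Ω)
    (D : Fin (p + 1) → Set PL.R3) (hD : ∀ r, PL.IsBoundedComponent (Γ r) (D r))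
    -- the component with index `0` is the external one
    (hext : closure Ω = closure (D 0) \ ⋃ r : Fin (p + 1), ⋃ _ : r ≠ 0, D r)
    -- the cycles on the boundary components
    (g : Fin (p + 1) → ℕ) (σ σh : ∀ r, Fin (g r) → PL.C1)
    (hσT : ∀ r s, PL.IsChainOf T (σ r s)) (hσΓ : ∀ r s, σ r s ∈ PL.cycles (Γ r))
    (hσhT : ∀ r s, PL.IsChainOf T (σh r s)) (hσhΓ : ∀ r s, σh r s ∈ PL.cycles (Γ r))
    (hbasis : ∀ r, PL.IsHomologyBasis (closure (D r)) (σ r))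
    (hbounds : ∀ r s, PL.BoundsIn (D r)ᶜ (σ r s))
    (hhbasis : ∀ r, PL.IsHomologyBasis (D r)ᶜ (σh r))
    (hhbounds : ∀ r s, PL.BoundsIn (closure (D r)) (σh r s))
    -- the retracted cycles
    (σm : ∀ r, Fin (g r) → PL.C1)
    (hσm : ∀ r s, PL.supp1 (σm r s) ⊆ (closure Ω)ᶜ)
    (hσmhom : ∀ r s, PL.HomologousIn Ωᶜ (σm r s) (PL.outer σ σh r s))
    -- the linking matrices
    (A : ∀ k i, Matrix (Fin (g k)) (Fin (g i)) ℤ)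
    (hA : ∀ k i, A k i = PL.linkingMatrix σm (PL.inner σ σh) k i) :
    -- all the linking numbers are well defined
    (∀ k i l j, ∃! n, PL.IsLinkingNumber (σm k l) (PL.inner σ σh i j) n) ∧
    (∀ i, i ≠ 0 → A 0 i = 0) ∧
    (∀ k, k ≠ 0 → A k 0 = 0) ∧
    (∀ k i, k ≠ 0 → i ≠ 0 → k ≠ i → A k i = 0) ∧
    (∀ r, PL.systemMatrix A r =
      Matrix.blockDiagonal' fun k : {k : Fin (p + 1) // k ≠ r} => A k k) := by
  open PL in
  have hcomp : ∀ r, ∃ x ∈ frontier Ω, connectedComponentIn (frontier Ω) x = Γ r := fun r => by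
    have h := Set.mem_range_self (f := Γ) r
    rwa [hΓ] at h
  have hΓF : ∀ r, Γ r ⊆ frontier Ω := fun r => by
    obtain ⟨x, -, hx⟩ := hcomp r
    exact hx ▸ connectedComponentIn_subset _ _
  have hΓpre : ∀ r, IsPreconnected (Γ r) := fun r => by
    obtain ⟨x, -, hx⟩ := hcomp r
    exact hx ▸ isPreconnected_connectedComponentIn
  have hΓcl : ∀ r, IsClosed (Γ r) := fun r => by
    obtain ⟨x, -, hx⟩ := hcomp r
    exact hx ▸ isClosed_connectedComponentIn isClosed_frontier _
  have hΓdisj : ∀ k i, k ≠ i → Disjoint (Γ k) (Γ i) := fun k i hki => by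
    obtain ⟨x, -, hx⟩ := hcomp k
    obtain ⟨y, -, hy⟩ := hcomp i
    refine Set.disjoint_left.2 fun z hz hz' => hki (hΓinj ?_)
    rw [← hx] at hz ⊢
    rw [← hy] at hz' ⊢
    rw [connectedComponentIn_eq hz, connectedComponentIn_eq hz']
  have hFcl : frontier Ω ⊆ closure Ω := frontier_subset_closure
  have hΩF : Disjoint Ω (frontier Ω) := by
    rw [hopen.frontier_eq]
    exact Set.disjoint_sdiff_right
  have hDopen : ∀ r, IsOpen (D r) := fun r => (hD r).isOpen (hΓcl r)
  have hDfr : ∀ r, frontier (D r) ⊆ Γ r := fun r => (hD r).frontier_subset (hΓcl r)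
  have hD0 : closure Ω ⊆ closure (D 0) := by
    rw [hext]
    exact Set.sdiff_subset
  have hDr : ∀ r, r ≠ 0 → Disjoint (D r) (closure Ω) := fun r hr => by
    rw [hext]
    refine Set.disjoint_left.2 fun x hx hx' => hx'.2 ?_
    exact Set.mem_iUnion₂.2 ⟨r, hr, hx⟩
  -- the component of the complement of `Γ r` that does not contain `Ω`
  have hside : ∀ r, ∃ E : Set R3, IsOpen E ∧ frontier E ⊆ Γ r ∧ Disjoint E Ω ∧ E.Nonempty ∧
      E ≠ Set.univ := by
    intro r
    by_cases hr : r = 0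
    · subst hr
      refine ⟨(closure (D 0))ᶜ, isClosed_closure.isOpen_compl, ?_, ?_, ?_, ?_⟩
      · rw [frontier_compl]
        exact frontier_closure_subset.trans (hDfr 0)
      · exact Set.disjoint_left.2 fun x hx hx' => hx (hD0 (subset_closure hx'))
      · rw [Set.nonempty_compl]
        exact ne_univ_of_isBounded (hD 0).1.closure
      · obtain ⟨x, hx⟩ := (hD 0).nonempty
        intro h
        exact (h.symm ▸ Set.mem_univ x : x ∈ (closure (D 0))ᶜ) (subset_closure hx)
    · exact ⟨D r, hDopen r, hDfr r, (hDr r hr).mono_right subset_closure, (hD r).nonempty,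
        ne_univ_of_isBounded (hD r).1⟩
  have hloc : ∀ r, ∀ x ∈ Γ r, IsLocallyConnectedNear Ω x := by
    intro r x hx
    obtain ⟨E, hE, hEΓ, hEΩ, hne, huniv⟩ := hside r
    exact hflat.isLocallyConnectedNear hopen hE (hEΓ.trans (hΓF r)) hEΩ (hΓF r hx)
      (hflat.subset_closure (hΓpre r) (hΓF r) hE hEΓ hne huniv hx)
  -- the cycles on `Γ i` bound on the side of `Γ i` that does not contain `Ω`
  have hbd : ∀ k i j, k ≠ i → ∃ B, Disjoint (Γ k) B ∧ inner σ σh i j ∈ boundaries B := by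
    intro k i j hki
    by_cases hi : i = 0
    · subst hi
      refine ⟨(D 0)ᶜ, ?_, ?_⟩
      -- A point of `Γ k` lies in `closure (D 0)`; outside `D 0` it would be on the frontier, hence
      -- on `Γ 0`.
      · refine Set.disjoint_left.2 fun x hx hx' => ?_
        have h1 : x ∈ closure (D 0) := hD0 (hFcl (hΓF k hx))
        have h2 : x ∈ frontier (D 0) := by
          rw [(hDopen 0).frontier_eq]
          exact ⟨h1, hx'⟩
        exact Set.disjoint_left.1 (hΓdisj k 0 hki) hx (hDfr 0 h2)
      · rw [PL.inner, if_pos rfl]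
        exact (boundsIn_iff.1 (hbounds 0 j)).2
    · refine ⟨closure (D i), ?_, ?_⟩
      · refine Set.disjoint_left.2 fun x hx hx' => ?_
        by_cases hxD : x ∈ D i
        · exact Set.disjoint_left.1 (hDr i hi) hxD (hFcl (hΓF k hx))
        · have h2 : x ∈ frontier (D i) := by
            rw [(hDopen i).frontier_eq]
            exact ⟨hx', hxD⟩
          exact Set.disjoint_left.1 (hΓdisj k i hki) hx (hDfr i h2)
      · rw [PL.inner, if_neg hi]
        exact (boundsIn_iff.1 (hhbounds i j)).2
  have hinner : ∀ i j, inner σ σh i j ∈ cycles (Γ i) := fun i j => by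
    unfold PL.inner
    split_ifs
    · exact hσΓ i j
    · exact hσhΓ i j
  have houter : ∀ k l, outer σ σh k l ∈ cycles (Γ k) := fun k l => by
    unfold outer
    split_ifs
    · exact hσhΓ k l
    · exact hσΓ k l
  have hsupp : ∀ k l i, Disjoint (supp1 (σm k l)) (Γ i) := fun k l i =>
    Set.disjoint_left.2 fun x hx hx' => hσm k l hx (hFcl (hΓF i hx'))
  have hexists : ∀ k i l j, ∃ n, IsLinkingNumber (σm k l) (inner σ σh i j) n := fun k i l j =>
    exists_isLinkingNumber (homologousIn_iff.1 (hσmhom k l)).1.1 (hinner i j).1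
      ((hsupp k l i).mono_right (hinner i j).2)
  -- All the vanishing claims are this one: `outer` and `inner` already encode the special role of
  -- the index `0`.
  have hzero : ∀ k i, k ≠ i → A k i = 0 := by
    intro k i hki
    ext l j
    -- A linking number exists, so the entry is a genuine one and not the default `0`.
    rw [hA, linkingMatrix, Matrix.of_apply, linkingNumber, dif_pos (hexists k i l j),
      Matrix.zero_apply]
    obtain ⟨B, hB, hdB⟩ := hbd k i j hki
    exact (hexists k i l j).choose_spec.eq_zero (hΓcl k) (hΓdisj k i hki) hB
      ((hΓF i).trans hFcl) (hloc i) (hsupp k l i) (hσmhom k l) (houter k l) (hinner i j) hdB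
  refine ⟨fun k i l j => ?_, fun i hi => hzero 0 i hi.symm, fun k hk => hzero k 0 hk,
    fun k i _ _ hki => hzero k i hki, fun r => ?_⟩
  · obtain ⟨n, hn⟩ := hexists k i l j
    exact ⟨n, hn, fun n' hn' => hn'.unique (hinner i j).1 hn⟩
  · ext ⟨k, l⟩ ⟨i, j⟩
    by_cases hki : k = i
    · subst hki
      rw [Matrix.blockDiagonal'_apply_eq]
      rfl
    · rw [Matrix.blockDiagonal'_apply_ne _ _ _ hki]
      change A k i l j = 0
      rw [hzero k i (fun h => hki (Subtype.ext h)), Matrix.zero_apply]
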